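/- Let $d\ge 3$ be an odd integer, let $F$ be a field of characteristic $0$ and let $q\in F$ be a root of unity of (exact) order $d$ (for instance $F=\Bbbk(q)$ with $\Bbbk$ a field of characteristic $0$). Let $U_q=U_q(sl(2|1))$ be the associative unital $F$-algebra generated by $k_1,k_1^{-1},k_2,k_2^{-1},e_1,e_2,f_1,f_2$ with the relations $$k_1k_1^{-1}=k_1^{-1}k_1=1,\quad k_2k_2^{-1}=k_2^{-1}k_2=1,\quad k_2k_1=k_1k_2,$$ $$e_1k_1=q^{-2}k_1e_1,\quad e_2k_1=qk_1e_2,\quad e_1k_2=qk_2e_1,\quad e_2k_2=k_2e_2,$$ $$k_1f_1=q^{-2}f_1k_1,\quad k_1f_2=qf_2k_1,\quad k_2f_1=qf_1k_2,\quad k_2f_2=f_2k_2,$$ $$e_1f_1=f_1e_1+\frac{k_1-k_1^{-1}}{q-q^{-1}},\quad e_2f_2=-f_2e_2+\frac{k_2-k_2^{-1}}{q-q^{-1}},\quad e_1f_2=f_2e_1,\quad e_2f_1=f_1e_2,\quad e_2^2=f_2^2=0,$$ $$e_1^2e_2-(q+q^{-1})e_1e_2e_1+e_2e_1^2=0,\qquad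 f_1^2f_2-(q+q^{-1})f_1f_2f_1+f_2f_1^2=0.$$ Put $e_3=e_1e_2-q^{-1}e_2e_1$ and $f_3=f_2f_1-qf_1f_2$, and let $\bar U_q=U_q/I$, where $I$ is the two-sided ideal generated by $f_1^d,\ k_1^d-1,\ k_2^d-1,\ e_1^d$. Theorem. The images in $\bar U_q$ of the monomials $$f_1^{w}f_3^{s}f_2^{l}k_1^{i}k_2^{j}e_1^{r}e_3^{h}e_2^{t},\qquad 0\le w,i,j,r\le d-1,\quad s,l,h,t\in\{0,1\},$$ are pairwise distinct and form a basis of $\bar U_q$ over $F$. In particular $\bar U_q$ is finite-dimensional over $F$ and $\dim_F\bar U_q=16d^4$. -/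

import Mathlib

namespace QuantumSl21

/-- The algebra generators `k₁, k₁⁻¹, k₂, k₂⁻¹, e₁, e₂, f₁, f₂`. -/
inductive Gen : Type
  | k1 | k1inv | k2 | k2inv | e1 | e2 | f1 | f2

/-- A generator, as an element of the free unital associative algebra. -/
def gen (F : Type*) [Field F] (g : Gen) : FreeAlgebra F Gen := FreeAlgebra.ι F g

open Gen in
/-- The defining relations of the quantum superalgebra `U_q(sl(2|1))`. -/
inductive Rel (F : Type*) [Field F] (q : F) : FreeAlgebra F Gen → FreeAlgebra F Gen → Prop
  | k1_k1inv : Rel F q (gen F k1 * gen F k1inv) 1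
  | k1inv_k1 : Rel F q (gen F k1inv * gen F k1) 1
  | k2_k2inv : Rel F q (gen F k2 * gen F k2inv) 1
  | k2inv_k2 : Rel F q (gen F k2inv * gen F k2) 1
  | k2_k1 : Rel F q (gen F k2 * gen F k1) (gen F k1 * gen F k2)
  | e1_k1 : Rel F q (gen F e1 * gen F k1) (q⁻¹ ^ 2 • (gen F k1 * gen F e1))
  | e2_k1 : Rel F q (gen F e2 * gen F k1) (q • (gen F k1 * gen F e2))
  | e1_k2 : Rel F q (gen F e1 * gen F k2) (q • (gen F k2 * gen F e1))
  | e2_k2 : Rel F q (gen F e2 * gen F k2) (gen F k2 * gen F e2)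
  | k1_f1 : Rel F q (gen F k1 * gen F f1) (q⁻¹ ^ 2 • (gen F f1 * gen F k1))
  | k1_f2 : Rel F q (gen F k1 * gen F f2) (q • (gen F f2 * gen F k1))
  | k2_f1 : Rel F q (gen F k2 * gen F f1) (q • (gen F f1 * gen F k2))
  | k2_f2 : Rel F q (gen F k2 * gen F f2) (gen F f2 * gen F k2)
  | e1_f1 : Rel F q (gen F e1 * gen F f1)
      (gen F f1 * gen F e1 + (q - q⁻¹)⁻¹ • (gen F k1 - gen F k1inv))
  | e2_f2 : Rel F q (gen F e2 * gen F f2)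
      (-(gen F f2 * gen F e2) + (q - q⁻¹)⁻¹ • (gen F k2 - gen F k2inv))
  | e1_f2 : Rel F q (gen F e1 * gen F f2) (gen F f2 * gen F e1)
  | e2_f1 : Rel F q (gen F e2 * gen F f1) (gen F f1 * gen F e2)
  | e2_sq : Rel F q (gen F e2 ^ 2) 0
  | f2_sq : Rel F q (gen F f2 ^ 2) 0
  | serre_e : Rel F q
      (gen F e1 ^ 2 * gen F e2 - (q + q⁻¹) • (gen F e1 * gen F e2 * gen F e1)
        + gen F e2 * gen F e1 ^ 2) 0
  | serre_f : Rel F q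
      (gen F f1 ^ 2 * gen F f2 - (q + q⁻¹) • (gen F f1 * gen F f2 * gen F f1)
        + gen F f2 * gen F f1 ^ 2) 0

/-- The unital associative algebra `U_q = U_q(sl(2|1))` over `F`, given by generators and
relations. -/
abbrev U (F : Type*) [Field F] (q : F) : Type _ := RingQuot (Rel F q)

section Elements

variable (F : Type*) [Field F] (q : F)

/-- The class of a generator in `U_q`. -/
def uGen (g : Gen) : U F q := RingQuot.mkAlgHom F (Rel F q) (gen F g)

def k₁ : U F q := uGen F q Gen.k1

def k₂ : U F q := uGen F q Gen.k2

def e₁ : U F q := uGen F q Gen.e1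

def e₂ : U F q := uGen F q Gen.e2

def f₁ : U F q := uGen F q Gen.f1

def f₂ : U F q := uGen F q Gen.f2

/-- `e₃ = e₁ e₂ - q⁻¹ e₂ e₁`. -/
def e₃ : U F q := e₁ F q * e₂ F q - q⁻¹ • (e₂ F q * e₁ F q)

/-- `f₃ = f₂ f₁ - q f₁ f₂`. -/
def f₃ : U F q := f₂ F q * f₁ F q - q • (f₁ F q * f₂ F q)

/-- The two-sided ideal `(f₁ᵈ, k₁ᵈ - 1, k₂ᵈ - 1, e₁ᵈ)` of `U_q`. -/
def I (d : ℕ) : TwoSidedIdeal (U F q) :=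
  TwoSidedIdeal.span {f₁ F q ^ d, k₁ F q ^ d - 1, k₂ F q ^ d - 1, e₁ F q ^ d}

/-- The quotient algebra `Ū_q` of `U_q` by the two-sided ideal `(f₁ᵈ, k₁ᵈ - 1, k₂ᵈ - 1, e₁ᵈ)`. -/
abbrev UBar (d : ℕ) : Type _ := (I F q d).ringCon.Quotient

/-- The canonical projection `U_q → Ū_q`. -/
def proj (d : ℕ) : U F q →ₐ[F] UBar F q d := RingCon.mkₐ F (I F q d).ringCon

end Elements

end QuantumSl21

/-! The monomials span by a triangular decomposition. They are independent because, applied to one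
vector of an explicit module, they give nonzero multiples of distinct coordinate vectors.

For independence, a module of the expected size is built in two stages. The pairs `e₁, e₂` and `f₁,
f₂` satisfy the same relations among themselves (Serre relation, square of the second zero, `d`-th
power of the first zero), so the explicit operators on `Ind d F` (`indF₂_sq`, `ind_serre`,
`indF₁_pow`) model both. Functions on `(ℤ/d)²` with values in `Ind d F` give the regular module of
the nonnegative part (`borelRegular`), and inducing it gives a module over the whole algebra
(`BorelAction.ind`). The formulas for the induced action are forced by commuting `e₁, e₂, k₁, k₂` to
the right past a monomial in the `f`s; cutting off at `f₁ᵈ = 0` is consistent because `[d] = 0`.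

The relations among the `e`s are not checked on all monomials. The elements `e₂²`, the Serre
expression and `e₁ᵈ` commute up to sign with `f₁` and `f₂`, so `end_eq_zero_of_commute` reduces them
to the inducing module. For `e₁ᵈ` this uses that `q²` has order `d`, hence that `d` is odd.

For spanning, (negative part)(torus)(positive part) contains `1` and is stable under left
multiplication by every generator. Each outer factor is spanned by ordered monomials
(`adjoin_pair_le_span`): the Serre relation says that the root vector `q`-commutes with the first
generator, and its square vanishes since `q² + 1 ≠ 0`. -/

namespace QuantumSl21

/-! ### The model of the negative part on the symbols `f₁ʷ f₃ˢ f₂ˡ` -/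

section NegativePart

variable {F : Type*} [Field F] (q : F) (d : ℕ)

/-- The symmetric `q`-integer `[n]`. -/
def qInt (n : ℕ) : F := (q ^ n - (q ^ n)⁻¹) / (q - q⁻¹)

/-- The free module on the symbols `f₁ʷ f₃ˢ f₂ˡ` with coefficients in `X`. -/
abbrev Ind (X : Type*) : Type _ := Fin d × Fin 2 × Fin 2 → X

variable {X Y : Type*} [AddCommGroup X] [Module F X] [AddCommGroup Y] [Module F Y]

variable (F) in
/-- The vector `f₁ʷ f₃ˢ f₂ˡ ⊗ x`, which vanishes when `d ≤ w`. -/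
def mono (w : ℕ) (s l : Fin 2) : X →ₗ[F] Ind d X :=
  if h : w < d then LinearMap.single F (fun _ => X) (⟨w, h⟩, s, l) else 0

/-- The linear map out of `Ind d X` with prescribed values on the vectors `mono d w s l x`. -/
def indLift (g : ℕ → Fin 2 → Fin 2 → X →ₗ[F] Y) : Ind d X →ₗ[F] Y :=
  LinearMap.lsum F (fun _ => X) F fun p => g p.1 p.2.1 p.2.2

variable {d}

theorem mono_of_le {w : ℕ} (h : d ≤ w) (s l : Fin 2) : mono F (X := X) d w s l = 0 :=
  dif_neg (not_lt.2 h)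

/-- Since `mono` vanishes for `w ≥ d`, a formula valid for all natural `w` defines an operator only
if its values vanish there too; then no boundary case `w = d - 1` needs separate treatment. -/
theorem indLift_mono (g : ℕ → Fin 2 → Fin 2 → X →ₗ[F] Y)
    (hg : ∀ w s l, d ≤ w → g w s l = 0) (w : ℕ) (s l : Fin 2) (x : X) :
    indLift (F := F) d g (mono F d w s l x) = g w s l x := by
  by_cases h : w < d
  · simp only [mono, dif_pos h, indLift]
    exact LinearMap.lsum_piSingle F (φ := fun _ => X) F _ _ x
  · rw [mono_of_le (not_lt.1 h), hg _ _ _ (not_lt.1 h)]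
    simp

theorem ind_ext {f g : Ind d X →ₗ[F] Y}
    (h : ∀ w s l x, f (mono F d w s l x) = g (mono F d w s l x)) : f = g := by
  refine LinearMap.pi_ext' fun p => LinearMap.ext fun x => ?_
  have := h p.1 p.2.1 p.2.2 x
  simpa [mono] using this

variable (d X)

variable (F) in
/-- Left multiplication by `f₁`. -/
def indF₁ : Module.End F (Ind d X) := indLift d fun w s l => mono F d (w + 1) s l

/-- The values of left multiplication by `f₂`. -/
def indF₂Fun (w : ℕ) : Fin 2 → Fin 2 → X →ₗ[F] Ind d X
  -- From `f₂ f₁ = q f₁ f₂ + f₃` and `f₃ f₁ = q⁻¹ f₁ f₃` one gets `f₂ f₁ʷ = qʷ f₁ʷ f₂ + [w] f₁ʷ⁻¹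
  -- f₃`; the other cases add `f₂ f₃ = -q f₃ f₂` and `f₂² = f₃² = 0`. At `w = 0` the truncated `w -
  -- 1` is harmless because `[0] = 0`.
  | 0, 0 => q ^ w • mono F d w 0 1 + qInt q w • mono F d (w - 1) 1 0
  | 0, 1 => qInt q w • mono F d (w - 1) 1 1
  | 1, 0 => -q ^ (w + 1) • mono F d w 1 1
  | 1, 1 => 0

/-- Left multiplication by `f₂`. -/
def indF₂ : Module.End F (Ind d X) := indLift d (indF₂Fun q d X)

variable {d X}

@[simp]
theorem indF₁_mono (w : ℕ) (s l : Fin 2) (x : X) :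
    indF₁ F d X (mono F d w s l x) = mono F d (w + 1) s l x :=
  indLift_mono _ (fun _ _ _ h => mono_of_le (Nat.le_succ_of_le h) _ _) _ _ _ _

theorem qInt_self (hq : q ^ d = 1) : qInt q d = 0 := by simp [qInt, hq]

variable {q}

/-- Operators that lower the exponent of `f₁` respect the cut-off: the only dangerous case is `w =
d`, where `[d] = 0` because `qᵈ = 1`. -/
theorem qInt_smul_mono_of_le (hq : q ^ d = 1) {w : ℕ} (h : d ≤ w) (s l : Fin 2) :
    qInt q w • mono F d (X := X) (w - 1) s l = 0 := by
  rcases h.eq_or_lt with rfl | h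
  · rw [qInt_self q hq, zero_smul]
  · rw [mono_of_le (Nat.le_sub_one_of_lt h), smul_zero]

theorem indF₂_mono (hq : q ^ d = 1) (w : ℕ) (s l : Fin 2) (x : X) :
    indF₂ q d X (mono F d w s l x) = indF₂Fun q d X w s l x := by
  refine indLift_mono _ (fun w s l h => ?_) w s l x
  fin_cases s <;> fin_cases l <;>
    simp [indF₂Fun, mono_of_le h, qInt_smul_mono_of_le hq h]

@[simp] theorem qInt_zero : qInt q 0 = 0 := by simp [qInt]

theorem indF₂_sq (hq : q ^ d = 1) : indF₂ q d X ^ 2 = 0 := by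
  refine ind_ext fun w s l x => ?_
  rw [pow_two, Module.End.mul_apply]
  fin_cases s <;> fin_cases l <;> rcases w with _ | w <;>
    simp [indF₂_mono hq, indF₂Fun]
  rw [smul_comm, ← sub_eq_add_neg, sub_eq_zero]

theorem ind_serre (hq : q ^ d = 1) (hq0 : q ≠ 0) (hq1 : q ^ 2 - 1 ≠ 0) :
    indF₁ F d X ^ 2 * indF₂ q d X - (q + q⁻¹) • (indF₁ F d X * indF₂ q d X * indF₁ F d X)
      + indF₂ q d X * indF₁ F d X ^ 2 = 0 := by
  refine ind_ext fun w s l x => ?_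
  have hw : q ^ w ≠ 0 := pow_ne_zero _ hq0
  have h1 : q - q⁻¹ ≠ 0 := by
    intro h; apply hq1; field_simp at h; linear_combination h
  fin_cases s <;> fin_cases l <;> rcases w with _ | w <;>
    simp [indF₂_mono hq, indF₂Fun, pow_two, qInt, add_assoc]
  all_goals
    match_scalars <;> field_simp <;> ring

theorem indF₁_pow_mono (n w : ℕ) (s l : Fin 2) (x : X) :
    (indF₁ F d X ^ n) (mono F d w s l x) = mono F d (w + n) s l x := by
  induction n with
  | zero => simp
  | succ n ih => rw [pow_succ', Module.End.mul_apply, ih, indF₁_mono, add_assoc]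

theorem indF₁_pow : indF₁ F d X ^ d = 0 :=
  ind_ext fun w s l x => by
    rw [indF₁_pow_mono, mono_of_le (Nat.le_add_left d w)]
    simp

variable (q) in
theorem ind_f₃_mono_zero (hq : q ^ d = 1) (hq0 : q ≠ 0) (hq1 : q ^ 2 - 1 ≠ 0) (l : Fin 2) (x : X) :
    (indF₂ q d X * indF₁ F d X - q • (indF₁ F d X * indF₂ q d X)) (mono F d 0 0 l x) =
      mono F d 0 1 l x := by
  have h : q - q⁻¹ ≠ 0 := by
    intro h; apply hq1; field_simp at h; linear_combination h
  fin_cases l <;> simp [indF₂_mono hq, indF₂Fun, qInt, h]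

/-- An operator that commutes with `f₁` and `f₂` up to scalars and kills the generating vectors is
zero. -/
theorem end_eq_zero_of_commute (hq : q ^ d = 1) (hq0 : q ≠ 0) (hq1 : q ^ 2 - 1 ≠ 0)
    {T : Module.End F (Ind d X)} (a b : F)
    (h₁ : T * indF₁ F d X = a • (indF₁ F d X * T))
    (h₂ : T * indF₂ q d X = b • (indF₂ q d X * T))
    (h₀ : ∀ x, T (mono F d 0 0 0 x) = 0) : T = 0 := by
  have h₁' (v) : T (indF₁ F d X v) = a • indF₁ F d X (T v) := LinearMap.congr_fun h₁ v
  have h₂' (v) : T (indF₂ q d X v) = b • indF₂ q d X (T v) := LinearMap.congr_fun h₂ v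
  -- The vanishing spreads from the generating vectors by applying `f₂`, then `f₃`, then powers of
  -- `f₁`.
  have h01 (l x) : T (mono F d 0 0 l x) = 0 := by
    fin_cases l
    · exact h₀ x
    · have : mono F d 0 0 1 x = indF₂ q d X (mono F d 0 0 0 x) := by
        simp [indF₂_mono hq, indF₂Fun]
      simp [this, h₂', h₀]
  have h0 (s l x) : T (mono F d 0 s l x) = 0 := by
    fin_cases s
    · exact h01 l x
    · have := ind_f₃_mono_zero q hq hq0 hq1 l x
      simp only [LinearMap.sub_apply, Module.End.mul_apply, LinearMap.smul_apply] at this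
      simp only [Fin.mk_one, ← this, map_sub, map_smul, h₁', h₂', h01]
      simp
  refine ind_ext fun w s l x => ?_
  induction w with
  | zero => simpa using h0 s l x
  | succ w ih => rw [← indF₁_mono, h₁', ih]; simp
end NegativePart
-- Induction from the nonnegative part: operators and torus relations
/-- A representation of the nonnegative part of the restricted quantum superalgebra. -/
structure BorelAction {F : Type*} [Field F] (q : F) (d : ℕ) (X : Type*) [AddCommGroup X]
    [Module F X] where
  k₁ : Module.End F X
  k₁' : Module.End F X
  k₂ : Module.End F X
  k₂' : Module.End F X
  e₁ : Module.End F X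
  e₂ : Module.End F X
  k₁_k₁' (x : X) : k₁ (k₁' x) = x
  k₁'_k₁ (x : X) : k₁' (k₁ x) = x
  k₂_k₂' (x : X) : k₂ (k₂' x) = x
  k₂'_k₂ (x : X) : k₂' (k₂ x) = x
  k₂_k₁ (x : X) : k₂ (k₁ x) = k₁ (k₂ x)
  e₁_k₁ (x : X) : e₁ (k₁ x) = q⁻¹ ^ 2 • k₁ (e₁ x)
  e₂_k₁ (x : X) : e₂ (k₁ x) = q • k₁ (e₂ x)
  e₁_k₂ (x : X) : e₁ (k₂ x) = q • k₂ (e₁ x)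
  e₂_k₂ (x : X) : e₂ (k₂ x) = k₂ (e₂ x)
  e₂_sq (x : X) : e₂ (e₂ x) = 0
  serre (x : X) : e₁ (e₁ (e₂ x)) - (q + q⁻¹) • e₁ (e₂ (e₁ x)) + e₂ (e₁ (e₁ x)) = 0
  k₁_pow : k₁ ^ d = 1
  k₂_pow : k₂ ^ d = 1
  e₁_pow : e₁ ^ d = 0

namespace BorelAction

variable {F : Type*} [Field F] {q : F} {d : ℕ} {X : Type*} [AddCommGroup X] [Module F X]
  (ρ : BorelAction q d X)

theorem k₂_k₁' (x : X) : ρ.k₂ (ρ.k₁' x) = ρ.k₁' (ρ.k₂ x) := by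
  rw [← ρ.k₁'_k₁ (ρ.k₂ (ρ.k₁' x)), ← ρ.k₂_k₁, ρ.k₁_k₁']

theorem k₂'_k₁ (x : X) : ρ.k₂' (ρ.k₁ x) = ρ.k₁ (ρ.k₂' x) := by
  rw [← ρ.k₂'_k₂ (ρ.k₁ (ρ.k₂' x)), ρ.k₂_k₁, ρ.k₂_k₂']

/-- The action of `k₁` on the induced module. -/
def indK₁ : Module.End F (Ind d X) := indLift d fun w s l =>
  ((q⁻¹ ^ 2) ^ w * q⁻¹ ^ (s : ℕ) * q ^ (l : ℕ)) • mono F d w s l ∘ₗ ρ.k₁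

/-- The action of `k₁⁻¹` on the induced module. -/
def indK₁' : Module.End F (Ind d X) := indLift d fun w s l =>
  ((q ^ 2) ^ w * q ^ (s : ℕ) * q⁻¹ ^ (l : ℕ)) • mono F d w s l ∘ₗ ρ.k₁'

/-- The action of `k₂` on the induced module. -/
def indK₂ : Module.End F (Ind d X) := indLift d fun w s l =>
  (q ^ w * q ^ (s : ℕ)) • mono F d w s l ∘ₗ ρ.k₂

/-- The action of `k₂⁻¹` on the induced module. -/
def indK₂' : Module.End F (Ind d X) := indLift d fun w s l =>
  (q⁻¹ ^ w * q⁻¹ ^ (s : ℕ)) • mono F d w s l ∘ₗ ρ.k₂'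

/-- The values of the action of `e₁` on the induced module. -/
def indE₁Fun (w : ℕ) (s l : Fin 2) : X →ₗ[F] Ind d X :=
  -- The middle term is the commutator of `e₁` with `f₁ʷ`, its torus elements moved right past `f₃ˢ
  -- f₂ˡ`. The last one comes from `e₁ f₃ = f₃ e₁ - q f₂ k₁`; for `l = 1` it dies with `f₂² = 0`.
  mono F d w s l ∘ₗ ρ.e₁ +
    (q - q⁻¹)⁻¹ • (qInt q w • mono F d (w - 1) s l) ∘ₗ
      ((q * q⁻¹ ^ w * q⁻¹ ^ (s : ℕ) * q ^ (l : ℕ)) • ρ.k₁ -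
        (q⁻¹ * q ^ w * q ^ (s : ℕ) * q⁻¹ ^ (l : ℕ)) • ρ.k₁') -
    (if s = 1 ∧ l = 0 then q else 0) • mono F d w 0 1 ∘ₗ ρ.k₁

/-- The action of `e₁` on the induced module. -/
def indE₁ : Module.End F (Ind d X) := indLift d ρ.indE₁Fun

/-- The values of the action of `e₂` on the induced module. -/
def indE₂Fun (w : ℕ) : Fin 2 → Fin 2 → X →ₗ[F] Ind d X
  | 0, 0 => mono F d w 0 0 ∘ₗ ρ.e₂
  | 0, 1 => -mono F d w 0 1 ∘ₗ ρ.e₂ + (q - q⁻¹)⁻¹ • mono F d w 0 0 ∘ₗ (ρ.k₂ - ρ.k₂')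
  -- The relation behind this is `e₂ f₃ = -f₃ e₂ + f₁ k₂⁻¹`, in which the `k₂` terms cancel.
  | 1, 0 => -mono F d w 1 0 ∘ₗ ρ.e₂ + mono F d (w + 1) 0 0 ∘ₗ ρ.k₂'
  | 1, 1 => mono F d w 1 1 ∘ₗ ρ.e₂ - (q - q⁻¹)⁻¹ • mono F d w 1 0 ∘ₗ (ρ.k₂ - ρ.k₂') +
      mono F d (w + 1) 0 1 ∘ₗ ρ.k₂'

/-- The action of `e₂` on the induced module. -/
def indE₂ : Module.End F (Ind d X) := indLift d ρ.indE₂Fun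

theorem indK₁_mono (w : ℕ) (s l : Fin 2) (x : X) : ρ.indK₁ (mono F d w s l x) =
    ((q⁻¹ ^ 2) ^ w * q⁻¹ ^ (s : ℕ) * q ^ (l : ℕ)) • mono F d w s l (ρ.k₁ x) :=
  indLift_mono _ (fun w s l h => by simp [mono_of_le h]) w s l x

theorem indK₁'_mono (w : ℕ) (s l : Fin 2) (x : X) : ρ.indK₁' (mono F d w s l x) =
    ((q ^ 2) ^ w * q ^ (s : ℕ) * q⁻¹ ^ (l : ℕ)) • mono F d w s l (ρ.k₁' x) :=
  indLift_mono _ (fun w s l h => by simp [mono_of_le h]) w s l x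

theorem indK₂_mono (w : ℕ) (s l : Fin 2) (x : X) : ρ.indK₂ (mono F d w s l x) =
    (q ^ w * q ^ (s : ℕ)) • mono F d w s l (ρ.k₂ x) :=
  indLift_mono _ (fun w s l h => by simp [mono_of_le h]) w s l x

theorem indK₂'_mono (w : ℕ) (s l : Fin 2) (x : X) : ρ.indK₂' (mono F d w s l x) =
    (q⁻¹ ^ w * q⁻¹ ^ (s : ℕ)) • mono F d w s l (ρ.k₂' x) :=
  indLift_mono _ (fun w s l h => by simp [mono_of_le h]) w s l x

theorem indE₁_mono (hq : q ^ d = 1) (w : ℕ) (s l : Fin 2) (x : X) :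
    ρ.indE₁ (mono F d w s l x) = ρ.indE₁Fun w s l x :=
  indLift_mono _ (fun w s l h => by
    simp [indE₁Fun, mono_of_le h, qInt_smul_mono_of_le hq h]) w s l x

theorem indE₂_mono (w : ℕ) (s l : Fin 2) (x : X) :
    ρ.indE₂ (mono F d w s l x) = ρ.indE₂Fun w s l x :=
  indLift_mono _ (fun w s l h => by
    fin_cases s <;> fin_cases l <;>
      simp [indE₂Fun, mono_of_le h, mono_of_le (Nat.le_succ_of_le h)]) w s l x

variable (hq : q ^ d = 1) (hq0 : q ≠ 0)

include hq0 in
theorem indK₁_indK₁' : ρ.indK₁ * ρ.indK₁' = 1 := by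
  refine ind_ext fun w s l x => ?_
  simp only [Module.End.mul_apply, indK₁_mono, indK₁'_mono, map_smul, smul_smul, ρ.k₁_k₁']
  fin_cases s <;> fin_cases l <;> simp <;> field_simp <;> simp

include hq0 in
theorem indK₁'_indK₁ : ρ.indK₁' * ρ.indK₁ = 1 := by
  refine ind_ext fun w s l x => ?_
  simp only [Module.End.mul_apply, indK₁_mono, indK₁'_mono, map_smul, smul_smul, ρ.k₁'_k₁]
  fin_cases s <;> fin_cases l <;> simp <;> field_simp <;> simp

include hq0 in
theorem indK₂_indK₂' : ρ.indK₂ * ρ.indK₂' = 1 := by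
  refine ind_ext fun w s l x => ?_
  simp only [Module.End.mul_apply, indK₂_mono, indK₂'_mono, map_smul, smul_smul, ρ.k₂_k₂']
  fin_cases s <;> simp <;> field_simp <;> simp

include hq0 in
theorem indK₂'_indK₂ : ρ.indK₂' * ρ.indK₂ = 1 := by
  refine ind_ext fun w s l x => ?_
  simp only [Module.End.mul_apply, indK₂_mono, indK₂'_mono, map_smul, smul_smul, ρ.k₂'_k₂]
  fin_cases s <;> simp <;> field_simp <;> simp

theorem indK₂_indK₁ : ρ.indK₂ * ρ.indK₁ = ρ.indK₁ * ρ.indK₂ := by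
  refine ind_ext fun w s l x => ?_
  simp only [Module.End.mul_apply, indK₂_mono, indK₁_mono, map_smul, smul_smul, ρ.k₂_k₁]
  ring_nf

theorem indK₁_indF₁ : ρ.indK₁ * indF₁ F d X = q⁻¹ ^ 2 • (indF₁ F d X * ρ.indK₁) := by
  refine ind_ext fun w s l x => ?_
  simp only [Module.End.mul_apply, indF₁_mono, indK₁_mono, map_smul, smul_smul,
    LinearMap.smul_apply]
  ring_nf

theorem indK₂_indF₁ : ρ.indK₂ * indF₁ F d X = q • (indF₁ F d X * ρ.indK₂) := by
  refine ind_ext fun w s l x => ?_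
  simp only [Module.End.mul_apply, indF₁_mono, indK₂_mono, map_smul, smul_smul,
    LinearMap.smul_apply]
  ring_nf

include hq hq0 in
theorem indK₁_indF₂ : ρ.indK₁ * indF₂ q d X = q • (indF₂ q d X * ρ.indK₁) := by
  refine ind_ext fun w s l x => ?_
  fin_cases s <;> fin_cases l <;> rcases w with _ | w <;>
    simp [indF₂_mono hq, indF₂Fun, indK₁_mono, smul_smul] <;>
    match_scalars <;> field_simp <;> ring

include hq hq0 in
theorem indK₂_indF₂ : ρ.indK₂ * indF₂ q d X = indF₂ q d X * ρ.indK₂ := by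
  refine ind_ext fun w s l x => ?_
  fin_cases s <;> fin_cases l <;> rcases w with _ | w <;>
    simp [indF₂_mono hq, indF₂Fun, indK₂_mono, smul_smul] <;>
    match_scalars <;> field_simp <;> ring

end BorelAction
-- Relations involving `e₁` and `e₂` on the induced module
namespace BorelAction

variable {F : Type*} [Field F] {q : F} {d : ℕ} {X : Type*} [AddCommGroup X] [Module F X]
  (ρ : BorelAction q d X)
variable (hq : q ^ d = 1) (hq0 : q ≠ 0) (hq1 : q ^ 2 - 1 ≠ 0)

include hq hq0 in
theorem indE₁_indK₁ : ρ.indE₁ * ρ.indK₁ = q⁻¹ ^ 2 • (ρ.indK₁ * ρ.indE₁) := by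
  refine ind_ext fun w s l x => ?_
  fin_cases s <;> fin_cases l <;> rcases w with _ | w <;>
    simp [indE₁_mono _ hq, indE₁Fun, indK₁_mono, ρ.e₁_k₁, ρ.k₁_k₁', ρ.k₁'_k₁] <;>
    match_scalars <;> field_simp <;> ring

include hq hq0 in
theorem indE₁_indK₂ : ρ.indE₁ * ρ.indK₂ = q • (ρ.indK₂ * ρ.indE₁) := by
  refine ind_ext fun w s l x => ?_
  fin_cases s <;> fin_cases l <;> rcases w with _ | w <;>
    simp [indE₁_mono _ hq, indE₁Fun, indK₂_mono, ρ.e₁_k₂, ρ.k₂_k₁, ρ.k₂_k₁'] <;>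
    match_scalars <;> field_simp <;> ring

include hq0 in
theorem indE₂_indK₁ : ρ.indE₂ * ρ.indK₁ = q • (ρ.indK₁ * ρ.indE₂) := by
  refine ind_ext fun w s l x => ?_
  fin_cases s <;> fin_cases l <;>
    simp [indE₂_mono, indE₂Fun, indK₁_mono, ρ.e₂_k₁, ρ.k₂_k₁, ρ.k₂'_k₁] <;>
    match_scalars <;> field_simp <;> ring

include hq0 in
theorem indE₂_indK₂ : ρ.indE₂ * ρ.indK₂ = ρ.indK₂ * ρ.indE₂ := by
  refine ind_ext fun w s l x => ?_
  fin_cases s <;> fin_cases l <;>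
    simp [indE₂_mono, indE₂Fun, indK₂_mono, ρ.e₂_k₂, ρ.k₂_k₂', ρ.k₂'_k₂] <;>
    match_scalars <;> field_simp <;> ring

include hq hq0 hq1 in
theorem indE₁_indF₁ : ρ.indE₁ * indF₁ F d X =
    indF₁ F d X * ρ.indE₁ + (q - q⁻¹)⁻¹ • (ρ.indK₁ - ρ.indK₁') := by
  refine ind_ext fun w s l x => ?_
  fin_cases s <;> fin_cases l <;> rcases w with _ | w <;>
    simp [indE₁_mono _ hq, indE₁Fun, indK₁_mono, indK₁'_mono, qInt, add_assoc] <;>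
    match_scalars <;> field_simp <;> ring

include hq hq0 hq1 in
theorem indE₂_indF₂ : ρ.indE₂ * indF₂ q d X =
    -(indF₂ q d X * ρ.indE₂) + (q - q⁻¹)⁻¹ • (ρ.indK₂ - ρ.indK₂') := by
  refine ind_ext fun w s l x => ?_
  fin_cases s <;> fin_cases l <;> rcases w with _ | w <;>
    simp [indE₂_mono, indE₂Fun, indF₂_mono hq, indF₂Fun, indK₂_mono, indK₂'_mono, qInt,
      add_assoc] <;>
    match_scalars <;> field_simp <;> ring

include hq hq0 hq1 in
theorem indE₁_indF₂ : ρ.indE₁ * indF₂ q d X = indF₂ q d X * ρ.indE₁ := by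
  refine ind_ext fun w s l x => ?_
  -- Both operators can lower the exponent of `f₁`, so `w - 1 - 1` occurs and `w = 1` needs its own
  -- case.
  fin_cases s <;> fin_cases l <;> rcases w with _ | _ | w <;>
    simp [indE₁_mono _ hq, indE₁Fun, indF₂_mono hq, indF₂Fun, qInt, add_assoc] <;>
    match_scalars <;> field_simp <;> ring

theorem indE₂_indF₁ : ρ.indE₂ * indF₁ F d X = indF₁ F d X * ρ.indE₂ := by
  refine ind_ext fun w s l x => ?_
  fin_cases s <;> fin_cases l <;> simp [indE₂_mono, indE₂Fun]

end BorelAction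
-- Commutation of `e₂²`, the Serre expression and `e₁ᵈ` with the `f`s
section Commutators

variable {F : Type*} [Field F] {q c : F} {A : Type*} [Ring A] [Algebra F A]
  {k₁ k₁' k₂ k₂' e₁ e₂ f₁ f₂ : A}

theorem mul_inv_eq_smul {a : F} (ha : a ≠ 0) {e k k' : A} (h : e * k = a • (k * e))
    (h₁ : k * k' = 1) (h₂ : k' * k = 1) : e * k' = a⁻¹ • (k' * e) := by
  have : k' * (e * k) * k' = a • (e * k') := by
    rw [h, mul_smul_comm, ← mul_assoc, h₂, one_mul, smul_mul_assoc]
  rw [mul_assoc, mul_assoc, h₁, mul_one] at this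
  rw [this, smul_smul, inv_mul_cancel₀ ha, one_smul]

/-- Right-nested form of a commutation rule, so that rewriting can use it inside longer products. -/
theorem mul_mul_eq_smul {a : F} {x y : A} (h : x * y = a • (y * x)) (z : A) :
    x * (y * z) = a • (y * (x * z)) := by
  rw [← mul_assoc, h, smul_mul_assoc, mul_assoc]

theorem mul_mul_eq_add_smul {a : F} {x y u v : A} (h : x * y = a • (y * x) + c • (u - v)) (z : A) :
    x * (y * z) = a • (y * (x * z)) + c • (u * z - v * z) := by
  rw [← mul_assoc, h, add_mul, smul_mul_assoc, mul_assoc, smul_mul_assoc, sub_mul]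

/-- The two torus terms have opposite signs and cancel because `e₂` commutes with `k₂` and `k₂⁻¹`.
-/
theorem e₂_sq_mul_f₂ (ek : e₂ * k₂ = (1 : F) • (k₂ * e₂)) (ek' : e₂ * k₂' = (1 : F) • (k₂' * e₂))
    (ef : e₂ * f₂ = (-1 : F) • (f₂ * e₂) + c • (k₂ - k₂')) : e₂ ^ 2 * f₂ = f₂ * e₂ ^ 2 := by
  simp only [pow_two, mul_assoc, ef, mul_mul_eq_add_smul ef, mul_add, mul_sub, mul_smul_comm, ek,
    ek']
  module

/-- Passing `f₁` through each `e₁` inserts `k₁ - k₁⁻¹`; once the torus elements are moved to the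
front, the coefficient `q + q⁻¹` is exactly what cancels them. -/
theorem serre_mul_f₁ (hq0 : q ≠ 0) (e₁k : e₁ * k₁ = q⁻¹ ^ 2 • (k₁ * e₁))
    (e₁k' : e₁ * k₁' = q ^ 2 • (k₁' * e₁)) (e₂k : e₂ * k₁ = q • (k₁ * e₂))
    (e₂k' : e₂ * k₁' = q⁻¹ • (k₁' * e₂))
    (e₁f : e₁ * f₁ = (1 : F) • (f₁ * e₁) + c • (k₁ - k₁')) (e₂f : e₂ * f₁ = (1 : F) • (f₁ * e₂)) :
    (e₁ ^ 2 * e₂ - (q + q⁻¹) • (e₁ * e₂ * e₁) + e₂ * e₁ ^ 2) * f₁ =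
      f₁ * (e₁ ^ 2 * e₂ - (q + q⁻¹) • (e₁ * e₂ * e₁) + e₂ * e₁ ^ 2) := by
  simp only [pow_two, mul_assoc, e₁f, mul_mul_eq_add_smul e₁f, e₂f, mul_mul_eq_smul e₂f, mul_add,
    mul_sub, add_mul, sub_mul, mul_smul_comm, smul_mul_assoc, e₁k, mul_mul_eq_smul e₁k, e₁k',
    mul_mul_eq_smul e₁k', e₂k, mul_mul_eq_smul e₂k, e₂k', mul_mul_eq_smul e₂k']
  match_scalars <;> field_simp <;> ring

/-- The sign arises because each term contains `e₂` once. The torus terms cancel by `q² - (q + q⁻¹)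
q + 1 = 0` and its analogue for `q⁻¹`. -/
theorem serre_mul_f₂ (hq0 : q ≠ 0) (e₁k : e₁ * k₂ = q • (k₂ * e₁))
    (e₁k' : e₁ * k₂' = q⁻¹ • (k₂' * e₁))
    (e₁f : e₁ * f₂ = (1 : F) • (f₂ * e₁)) (e₂f : e₂ * f₂ = (-1 : F) • (f₂ * e₂) + c • (k₂ - k₂')) :
    (e₁ ^ 2 * e₂ - (q + q⁻¹) • (e₁ * e₂ * e₁) + e₂ * e₁ ^ 2) * f₂ =
      -(f₂ * (e₁ ^ 2 * e₂ - (q + q⁻¹) • (e₁ * e₂ * e₁) + e₂ * e₁ ^ 2)) := by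
  simp only [pow_two, mul_assoc, e₁f, mul_mul_eq_add_smul e₂f, e₂f, mul_mul_eq_smul e₁f, mul_add,
    mul_sub, add_mul, sub_mul, mul_smul_comm, smul_mul_assoc, e₁k, mul_mul_eq_smul e₁k, e₁k',
    mul_mul_eq_smul e₁k']
  match_scalars <;> field_simp <;> ring

theorem e₁_pow_mul_f₁ (ek : e₁ * k₁ = q⁻¹ ^ 2 • (k₁ * e₁))
    (ek' : e₁ * k₁' = q ^ 2 • (k₁' * e₁)) (ef : e₁ * f₁ = f₁ * e₁ + c • (k₁ - k₁')) (n : ℕ) :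
    e₁ ^ (n + 1) * f₁ = f₁ * e₁ ^ (n + 1) +
      c • ((∑ i ∈ Finset.range (n + 1), (q⁻¹ ^ 2) ^ i) • (k₁ * e₁ ^ n) -
        (∑ i ∈ Finset.range (n + 1), (q ^ 2) ^ i) • (k₁' * e₁ ^ n)) := by
  induction n with
  | zero => simpa using ef
  | succ n ih =>
    rw [pow_succ' e₁ (n + 1), mul_assoc, ih, geom_sum_succ (n := n + 1),
      geom_sum_succ (n := n + 1), mul_add, ← mul_assoc e₁ f₁, ef]
    simp only [mul_sub, mul_smul_comm, mul_mul_eq_smul ek, mul_mul_eq_smul ek', add_mul,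
      smul_mul_assoc, sub_mul, ← mul_assoc, pow_succ' e₁ n]
    module

/-- The torus coefficients are full geometric sums of the primitive `d`-th roots `q⁻²` and `q²`,
hence zero. -/
theorem e₁_pow_mul_f₁_eq {d : ℕ} (hd : 1 < d) (hq : IsPrimitiveRoot (q ^ 2) d)
    (ek : e₁ * k₁ = q⁻¹ ^ 2 • (k₁ * e₁)) (ek' : e₁ * k₁' = q ^ 2 • (k₁' * e₁))
    (ef : e₁ * f₁ = f₁ * e₁ + c • (k₁ - k₁')) : e₁ ^ d * f₁ = f₁ * e₁ ^ d := by
  obtain ⟨n, rfl⟩ : ∃ n, d = n + 1 := ⟨d - 1, by omega⟩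
  rw [e₁_pow_mul_f₁ ek ek' ef, inv_pow, hq.inv.geom_sum_eq_zero hd, hq.geom_sum_eq_zero hd]
  simp

end Commutators
-- The regular module of the nonnegative part
section Torus

variable {F : Type*} [Field F] {q : F} {d : ℕ} {Y : Type*} [AddCommGroup Y] [Module F Y]

variable (F Y) in
/-- Translation of functions on the torus `(ℤ/d)²`. -/
def translate (a : ZMod d × ZMod d) : Module.End F (ZMod d × ZMod d → Y) :=
  LinearMap.funLeft F Y fun p => p - a

@[simp]
theorem translate_apply (a : ZMod d × ZMod d) (φ : ZMod d × ZMod d → Y) (p : ZMod d × ZMod d) :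
    translate F Y a φ p = φ (p - a) := rfl

theorem translate_pow (a : ZMod d × ZMod d) (n : ℕ) :
    translate F Y a ^ n = translate F Y (n • a) := by
  induction n with
  | zero => ext; simp
  | succ n ih =>
    rw [pow_succ, ih]
    refine LinearMap.ext fun φ => funext fun p => ?_
    simp [add_mul, sub_sub]

theorem translate_single (a p : ZMod d × ZMod d) (y : Y) :
    translate F Y a (Pi.single p y) = Pi.single (p + a) y := by
  funext r
  simp [Pi.single_apply, sub_eq_iff_eq_add]

/-- Pointwise application of an endomorphism, weighted by a function on the torus. -/
def weighted (w : ZMod d × ZMod d → F) (e : Module.End F Y) :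
    Module.End F (ZMod d × ZMod d → Y) :=
  LinearMap.pi fun p => w p • e ∘ₗ LinearMap.proj p

@[simp]
theorem weighted_apply (w : ZMod d × ZMod d → F) (e : Module.End F Y) (φ : ZMod d × ZMod d → Y)
    (p : ZMod d × ZMod d) : weighted w e φ p = w p • e (φ p) := rfl

theorem weighted_pow (w : ZMod d × ZMod d → F) (e : Module.End F Y) (n : ℕ) :
    weighted w e ^ n = weighted (w ^ n) (e ^ n) := by
  induction n with
  | zero => ext; simp
  | succ n ih =>
    rw [pow_succ, ih]
    refine LinearMap.ext fun φ => funext fun p => ?_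
    simp [smul_smul, pow_succ]

theorem weighted_single_zero (w : ZMod d × ZMod d → F) (hw : w 0 = 1) (e : Module.End F Y) (y : Y) :
    weighted w e (Pi.single 0 y) = Pi.single 0 (e y) := by
  funext p
  by_cases hp : p = 0
  · subst hp; simp [hw]
  · simp [hp]

/-- The nonnegative part acting on itself: the torus of rank two acts by translations and the
positive part acts with the corresponding weights. -/
def borelRegular [NeZero d] (hq : q ^ d = 1) (hq0 : q ≠ 0) (hq1 : q ^ 2 - 1 ≠ 0) :
    BorelAction q d (ZMod d × ZMod d → Ind d F) where
  k₁ := translate F _ (1, 0)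
  k₁' := translate F _ (-1, 0)
  k₂ := translate F _ (0, 1)
  k₂' := translate F _ (0, -1)
  -- The point `(i, j)` stands for `k₁ⁱ k₂ʲ`, and the weight is the scalar in `e₁ k₁ⁱ k₂ʲ =
  -- q^(-2i+j) k₁ⁱ k₂ʲ e₁`; likewise `e₂ k₁ⁱ = qⁱ k₁ⁱ e₂`.
  e₁ := weighted (fun p => AddChar.zmodChar d hq (-p.1 - p.1 + p.2)) (indF₁ F d F)
  e₂ := weighted (fun p => AddChar.zmodChar d hq p.1) (indF₂ q d F)
  k₁_k₁' φ := by funext p; simp [sub_sub, ← Prod.zero_eq_mk]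
  k₁'_k₁ φ := by funext p; simp [sub_sub, ← Prod.zero_eq_mk]
  k₂_k₂' φ := by funext p; simp [sub_sub, ← Prod.zero_eq_mk]
  k₂'_k₂ φ := by funext p; simp [sub_sub, ← Prod.zero_eq_mk]
  k₂_k₁ φ := by funext p; simp [sub_sub]
  e₁_k₁ φ := by
    funext p
    have h : -p.1 - p.1 + p.2 = -1 + -1 + (-(p.1 - 1) - (p.1 - 1) + p.2) := by ring
    have hc : AddChar.zmodChar d hq (-1) = q⁻¹ := by
      rw [AddChar.map_neg_eq_inv]
      simpa using congrArg (·⁻¹) (AddChar.zmodChar_apply' hq 1)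
    simp only [weighted_apply, translate_apply, Pi.smul_apply, smul_smul, Prod.fst_sub,
      Prod.snd_sub, sub_zero]
    rw [h, AddChar.map_add_eq_mul, AddChar.map_add_eq_mul, hc, pow_two]
  e₂_k₁ φ := by
    funext p
    have h : p.1 = 1 + (p.1 - 1) := by ring
    have hc : AddChar.zmodChar d hq 1 = q := by
      simpa using AddChar.zmodChar_apply' hq 1
    simp only [weighted_apply, translate_apply, Pi.smul_apply, smul_smul, Prod.fst_sub]
    conv_lhs => rw [h, AddChar.map_add_eq_mul, hc]
  e₁_k₂ φ := by
    funext p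
    have h : -p.1 - p.1 + p.2 = 1 + (-p.1 - p.1 + (p.2 - 1)) := by ring
    have hc : AddChar.zmodChar d hq 1 = q := by
      simpa using AddChar.zmodChar_apply' hq 1
    simp only [weighted_apply, translate_apply, Pi.smul_apply, smul_smul, Prod.fst_sub,
      Prod.snd_sub, sub_zero]
    conv_lhs => rw [h, AddChar.map_add_eq_mul, hc]
  e₂_k₂ φ := by funext p; simp
  e₂_sq φ := by
    funext p
    have h := LinearMap.congr_fun (indF₂_sq (X := F) hq) (φ p)
    rw [pow_two, Module.End.mul_apply] at h
    simp [h]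
  serre φ := by
    funext p
    have h := LinearMap.congr_fun (ind_serre (X := F) hq hq0 hq1) (φ p)
    simp only [pow_two, Module.End.mul_apply, LinearMap.add_apply, LinearMap.sub_apply,
      LinearMap.smul_apply, LinearMap.zero_apply] at h
    simp only [Pi.add_apply, Pi.sub_apply, Pi.smul_apply, weighted_apply, map_smul, Pi.zero_apply]
    generalize AddChar.zmodChar d hq (-p.1 - p.1 + p.2) = a
    generalize AddChar.zmodChar d hq p.1 = b
    -- Every Serre term contains `e₁` twice and `e₂` once, so at a fixed point all carry the same
    -- weight `a * a * b`.
    rw [← smul_zero (a * a * b), ← h]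
    module
  k₁_pow := by
    rw [translate_pow]; refine LinearMap.ext fun φ => funext fun p => ?_; simp [← Prod.zero_eq_mk]
  k₂_pow := by
    rw [translate_pow]; refine LinearMap.ext fun φ => funext fun p => ?_; simp [← Prod.zero_eq_mk]
  e₁_pow := by
    rw [weighted_pow, indF₁_pow]; refine LinearMap.ext fun φ => funext fun p => ?_; simp

end Torus

/-! ### Universal property of `Ū_q` -/

section Lift

variable {F : Type*} [Field F] {q : F} {d : ℕ}

/-- Elements of an algebra that satisfy the defining relations of the restricted quantum
superalgebra. -/
structure Realization (q : F) (d : ℕ) (A : Type*) [Ring A] [Algebra F A] where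
  k₁ : A
  k₁' : A
  k₂ : A
  k₂' : A
  e₁ : A
  e₂ : A
  f₁ : A
  f₂ : A
  k₁_k₁' : k₁ * k₁' = 1
  k₁'_k₁ : k₁' * k₁ = 1
  k₂_k₂' : k₂ * k₂' = 1
  k₂'_k₂ : k₂' * k₂ = 1
  k₂_k₁ : k₂ * k₁ = k₁ * k₂
  e₁_k₁ : e₁ * k₁ = q⁻¹ ^ 2 • (k₁ * e₁)
  e₂_k₁ : e₂ * k₁ = q • (k₁ * e₂)
  e₁_k₂ : e₁ * k₂ = q • (k₂ * e₁)
  e₂_k₂ : e₂ * k₂ = k₂ * e₂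
  k₁_f₁ : k₁ * f₁ = q⁻¹ ^ 2 • (f₁ * k₁)
  k₁_f₂ : k₁ * f₂ = q • (f₂ * k₁)
  k₂_f₁ : k₂ * f₁ = q • (f₁ * k₂)
  k₂_f₂ : k₂ * f₂ = f₂ * k₂
  e₁_f₁ : e₁ * f₁ = f₁ * e₁ + (q - q⁻¹)⁻¹ • (k₁ - k₁')
  e₂_f₂ : e₂ * f₂ = -(f₂ * e₂) + (q - q⁻¹)⁻¹ • (k₂ - k₂')
  e₁_f₂ : e₁ * f₂ = f₂ * e₁
  e₂_f₁ : e₂ * f₁ = f₁ * e₂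
  e₂_sq : e₂ ^ 2 = 0
  f₂_sq : f₂ ^ 2 = 0
  serre_e : e₁ ^ 2 * e₂ - (q + q⁻¹) • (e₁ * e₂ * e₁) + e₂ * e₁ ^ 2 = 0
  serre_f : f₁ ^ 2 * f₂ - (q + q⁻¹) • (f₁ * f₂ * f₁) + f₂ * f₁ ^ 2 = 0
  f₁_pow : f₁ ^ d = 0
  k₁_pow : k₁ ^ d = 1
  k₂_pow : k₂ ^ d = 1
  e₁_pow : e₁ ^ d = 0

namespace Realization

variable {A : Type*} [Ring A] [Algebra F A] (R : Realization q d A)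

/-- The image of a generator. -/
def onGen : Gen → A
  | .k1 => R.k₁
  | .k1inv => R.k₁'
  | .k2 => R.k₂
  | .k2inv => R.k₂'
  | .e1 => R.e₁
  | .e2 => R.e₂
  | .f1 => R.f₁
  | .f2 => R.f₂

/-- The homomorphism from `U_q` determined by a realization. -/
def liftU : U F q →ₐ[F] A :=
  RingQuot.liftAlgHom F ⟨FreeAlgebra.lift F R.onGen, fun x y h => by
    cases h <;> simp only [gen, map_mul, map_add, map_sub, map_smul, map_pow, map_neg, map_one,
      map_zero, FreeAlgebra.lift_ι_apply, onGen, R.k₁_k₁', R.k₁'_k₁, R.k₂_k₂', R.k₂'_k₂, R.k₂_k₁,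
      R.e₁_k₁, R.e₂_k₁, R.e₁_k₂, R.e₂_k₂, R.k₁_f₁, R.k₁_f₂, R.k₂_f₁, R.k₂_f₂, R.e₁_f₁, R.e₂_f₂,
      R.e₁_f₂, R.e₂_f₁, R.e₂_sq, R.f₂_sq, R.serre_e, R.serre_f]⟩

@[simp]
theorem liftU_uGen (g : Gen) : R.liftU (uGen F q g) = R.onGen g := by
  simp [liftU, uGen, gen]

@[simp] theorem liftU_k₁ : R.liftU (QuantumSl21.k₁ F q) = R.k₁ := R.liftU_uGen _
@[simp] theorem liftU_k₂ : R.liftU (QuantumSl21.k₂ F q) = R.k₂ := R.liftU_uGen _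
@[simp] theorem liftU_e₁ : R.liftU (QuantumSl21.e₁ F q) = R.e₁ := R.liftU_uGen _
@[simp] theorem liftU_e₂ : R.liftU (QuantumSl21.e₂ F q) = R.e₂ := R.liftU_uGen _
@[simp] theorem liftU_f₁ : R.liftU (QuantumSl21.f₁ F q) = R.f₁ := R.liftU_uGen _
@[simp] theorem liftU_f₂ : R.liftU (QuantumSl21.f₂ F q) = R.f₂ := R.liftU_uGen _

theorem I_le_ker : (I F q d).ringCon ≤ RingCon.ker R.liftU.toRingHom := by
  have h : I F q d ≤ TwoSidedIdeal.ker R.liftU := by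
    refine TwoSidedIdeal.span_le.2 ?_
    rintro x (rfl | rfl | rfl | rfl) <;>
      simp [TwoSidedIdeal.mem_ker, R.f₁_pow, R.k₁_pow, R.k₂_pow, R.e₁_pow]
  intro x y hxy
  have := (TwoSidedIdeal.mem_ker _).1 (h ((TwoSidedIdeal.rel_iff _ _ _).1 hxy))
  rw [map_sub, sub_eq_zero] at this
  exact this

/-- The homomorphism from `Ū_q` determined by a realization. -/
def lift : UBar F q d →ₐ[F] A := RingCon.liftₐ _ R.liftU R.I_le_ker

@[simp]
theorem lift_proj (u : U F q) : R.lift (proj F q d u) = R.liftU u := rfl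

end Realization

end Lift
-- The induced representation of `Ū_q`
section RegularRepresentation

variable {F : Type*} [Field F] {q : F} {d : ℕ} {X : Type*} [AddCommGroup X] [Module F X]

namespace BorelAction

variable (ρ : BorelAction q d X)

theorem indE₁_mono_zero (hq : q ^ d = 1) (x : X) :
    ρ.indE₁ (mono F d 0 0 0 x) = mono F d 0 0 0 (ρ.e₁ x) := by
  simp [indE₁_mono _ hq, indE₁Fun]

theorem indE₂_mono_zero (x : X) :
    ρ.indE₂ (mono F d 0 0 0 x) = mono F d 0 0 0 (ρ.e₂ x) := by
  simp [indE₂_mono, indE₂Fun]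

theorem indK₁_mono_zero (x : X) :
    ρ.indK₁ (mono F d 0 0 0 x) = mono F d 0 0 0 (ρ.k₁ x) := by
  simp [indK₁_mono]

theorem indK₂_mono_zero (x : X) :
    ρ.indK₂ (mono F d 0 0 0 x) = mono F d 0 0 0 (ρ.k₂ x) := by
  simp [indK₂_mono]

end BorelAction

/-- If `T` and `t` are intertwined by `ι`, then so are their powers. -/
theorem pow_apply_of_intertwines {V : Type*} [AddCommGroup V] [Module F V] {T : Module.End F V}
    {t : Module.End F X} {ι : X → V} (h : ∀ x, T (ι x) = ι (t x)) (n : ℕ) (x : X) :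
    (T ^ n) (ι x) = ι ((t ^ n) x) := by
  induction n with
  | zero => simp
  | succ n ih => rw [pow_succ', Module.End.mul_apply, ih, h, pow_succ', Module.End.mul_apply]

theorem pow_indK₁ (ρ : BorelAction q d X) (hq : q ^ d = 1) : ρ.indK₁ ^ d = 1 := by
  have h (n w : ℕ) (s l : Fin 2) (x : X) : (ρ.indK₁ ^ n) (mono F d w s l x) =
      ((q⁻¹ ^ 2) ^ w * q⁻¹ ^ (s : ℕ) * q ^ (l : ℕ)) ^ n • mono F d w s l ((ρ.k₁ ^ n) x) := by
    induction n with
    | zero => simp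
    | succ n ih =>
      rw [pow_succ', Module.End.mul_apply, ih, map_smul, ρ.indK₁_mono, smul_smul, ← pow_succ,
        pow_succ' (M := Module.End F X), Module.End.mul_apply]
  refine ind_ext fun w s l x => ?_
  have hq' : q⁻¹ ^ d = 1 := by rw [inv_pow, hq, inv_one]
  rw [h, ρ.k₁_pow, mul_pow, mul_pow, pow_right_comm (q⁻¹ ^ 2), pow_right_comm q⁻¹ 2,
    pow_right_comm q⁻¹ (s : ℕ), pow_right_comm q (l : ℕ), hq, hq']
  simp

theorem pow_indK₂ (ρ : BorelAction q d X) (hq : q ^ d = 1) : ρ.indK₂ ^ d = 1 := by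
  have h (n w : ℕ) (s l : Fin 2) (x : X) : (ρ.indK₂ ^ n) (mono F d w s l x) =
      (q ^ w * q ^ (s : ℕ)) ^ n • mono F d w s l ((ρ.k₂ ^ n) x) := by
    induction n with
    | zero => simp
    | succ n ih =>
      rw [pow_succ', Module.End.mul_apply, ih, map_smul, ρ.indK₂_mono, smul_smul, ← pow_succ,
        pow_succ' (M := Module.End F X), Module.End.mul_apply]
  refine ind_ext fun w s l x => ?_
  rw [h, ρ.k₂_pow, ← pow_add, ← pow_mul, mul_comm, pow_mul, hq]
  simp

/-- The restricted quantum superalgebra acts on the module induced from a representation of its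
nonnegative part. -/
def BorelAction.ind (ρ : BorelAction q d X) (hd : 1 < d) (hq : q ^ d = 1) (hq0 : q ≠ 0)
    (hq2 : IsPrimitiveRoot (q ^ 2) d) : Realization q d (Module.End F (Ind d X)) :=
  have hq1 : q ^ 2 - 1 ≠ 0 := sub_ne_zero.2 (hq2.ne_one hd)
  have e₁k₁' : ρ.indE₁ * ρ.indK₁' = q ^ 2 • (ρ.indK₁' * ρ.indE₁) := by
    have := mul_inv_eq_smul (pow_ne_zero 2 (inv_ne_zero hq0)) (ρ.indE₁_indK₁ hq hq0)
      (ρ.indK₁_indK₁' hq0) (ρ.indK₁'_indK₁ hq0)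
    rwa [inv_pow, inv_inv] at this
  have e₁k₂' : ρ.indE₁ * ρ.indK₂' = q⁻¹ • (ρ.indK₂' * ρ.indE₁) :=
    mul_inv_eq_smul hq0 (ρ.indE₁_indK₂ hq hq0) (ρ.indK₂_indK₂' hq0) (ρ.indK₂'_indK₂ hq0)
  have e₂k₁' : ρ.indE₂ * ρ.indK₁' = q⁻¹ • (ρ.indK₁' * ρ.indE₂) :=
    mul_inv_eq_smul hq0 (ρ.indE₂_indK₁ hq0) (ρ.indK₁_indK₁' hq0) (ρ.indK₁'_indK₁ hq0)
  have e₂k₂ : ρ.indE₂ * ρ.indK₂ = (1 : F) • (ρ.indK₂ * ρ.indE₂) := by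
    rw [one_smul, ρ.indE₂_indK₂ hq0]
  have e₂k₂' : ρ.indE₂ * ρ.indK₂' = (1 : F) • (ρ.indK₂' * ρ.indE₂) := by
    simpa using mul_inv_eq_smul one_ne_zero e₂k₂ (ρ.indK₂_indK₂' hq0) (ρ.indK₂'_indK₂ hq0)
  { k₁ := ρ.indK₁
    k₁' := ρ.indK₁'
    k₂ := ρ.indK₂
    k₂' := ρ.indK₂'
    e₁ := ρ.indE₁
    e₂ := ρ.indE₂
    f₁ := indF₁ F d X
    f₂ := indF₂ q d X
    k₁_k₁' := ρ.indK₁_indK₁' hq0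
    k₁'_k₁ := ρ.indK₁'_indK₁ hq0
    k₂_k₂' := ρ.indK₂_indK₂' hq0
    k₂'_k₂ := ρ.indK₂'_indK₂ hq0
    k₂_k₁ := ρ.indK₂_indK₁
    e₁_k₁ := ρ.indE₁_indK₁ hq hq0
    e₂_k₁ := ρ.indE₂_indK₁ hq0
    e₁_k₂ := ρ.indE₁_indK₂ hq hq0
    e₂_k₂ := ρ.indE₂_indK₂ hq0
    k₁_f₁ := ρ.indK₁_indF₁
    k₁_f₂ := ρ.indK₁_indF₂ hq hq0
    k₂_f₁ := ρ.indK₂_indF₁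
    k₂_f₂ := ρ.indK₂_indF₂ hq hq0
    e₁_f₁ := ρ.indE₁_indF₁ hq hq0 hq1
    e₂_f₂ := ρ.indE₂_indF₂ hq hq0 hq1
    e₁_f₂ := ρ.indE₁_indF₂ hq hq0 hq1
    e₂_f₁ := ρ.indE₂_indF₁
    e₂_sq := by
      refine end_eq_zero_of_commute hq hq0 hq1 1 1 ?_ ?_ fun x => ?_
      · rw [pow_two, mul_assoc, ρ.indE₂_indF₁, ← mul_assoc, ρ.indE₂_indF₁, mul_assoc, one_smul]
      · rw [one_smul]
        exact e₂_sq_mul_f₂ e₂k₂ e₂k₂' (by rw [neg_one_smul]; exact ρ.indE₂_indF₂ hq hq0 hq1)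
      · simp [pow_two, ρ.indE₂_mono_zero, ρ.e₂_sq]
    f₂_sq := indF₂_sq hq
    serre_e := by
      -- The scalar `-1` records that the Serre expression anticommutes with `f₂`.
      refine end_eq_zero_of_commute hq hq0 hq1 1 (-1) ?_ ?_ fun x => ?_
      · rw [one_smul]
        exact serre_mul_f₁ hq0 (ρ.indE₁_indK₁ hq hq0) e₁k₁' (ρ.indE₂_indK₁ hq0) e₂k₁'
          (by rw [one_smul]; exact ρ.indE₁_indF₁ hq hq0 hq1) (by rw [one_smul, ρ.indE₂_indF₁])
      · exact (serre_mul_f₂ hq0 (ρ.indE₁_indK₂ hq hq0) e₁k₂'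
          (by rw [one_smul, ρ.indE₁_indF₂ hq hq0 hq1])
          (by rw [neg_one_smul]; exact ρ.indE₂_indF₂ hq hq0 hq1)).trans (neg_one_smul F _).symm
      · simp only [pow_two, LinearMap.add_apply, LinearMap.sub_apply, LinearMap.smul_apply,
          Module.End.mul_apply, ρ.indE₂_mono_zero, ρ.indE₁_mono_zero hq]
        rw [← map_smul, ← map_sub, ← map_add, ρ.serre, map_zero]
    serre_f := ind_serre hq hq0 hq1
    f₁_pow := indF₁_pow
    k₁_pow := pow_indK₁ ρ hq
    k₂_pow := pow_indK₂ ρ hq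
    e₁_pow := by
      refine end_eq_zero_of_commute hq hq0 hq1 1 1 ?_ ?_ fun x => ?_
      · rw [one_smul]
        exact e₁_pow_mul_f₁_eq hd hq2 (ρ.indE₁_indK₁ hq hq0) e₁k₁' (ρ.indE₁_indF₁ hq hq0 hq1)
      · rw [one_smul]
        exact Commute.pow_left (ρ.indE₁_indF₂ hq hq0 hq1) d
      · rw [pow_apply_of_intertwines (ρ.indE₁_mono_zero hq), ρ.e₁_pow]
        simp }

end RegularRepresentation

/-! ### Linear independence of the monomials -/

section Independence

variable {F : Type*} [Field F] {q : F} {d : ℕ}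

/-- The monomial `f₁ʷ f₃ˢ f₂ˡ k₁ⁱ k₂ʲ e₁ʳ e₃ʰ e₂ᵗ` in `U_q`. -/
def pbw (q : F) (d : ℕ) (p : Fin d × Fin 2 × Fin 2 × Fin d × Fin d × Fin d × Fin 2 × Fin 2) :
    U F q :=
  f₁ F q ^ (p.1 : ℕ) * f₃ F q ^ (p.2.1 : ℕ) * f₂ F q ^ (p.2.2.1 : ℕ) *
    k₁ F q ^ (p.2.2.2.1 : ℕ) * k₂ F q ^ (p.2.2.2.2.1 : ℕ) *
    e₁ F q ^ (p.2.2.2.2.2.1 : ℕ) * e₃ F q ^ (p.2.2.2.2.2.2.1 : ℕ) *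
    e₂ F q ^ (p.2.2.2.2.2.2.2 : ℕ)

theorem mono_fin {X : Type*} [AddCommGroup X] [Module F X] (w : Fin d) (s l : Fin 2) (x : X) :
    mono F d w s l x = Pi.single (w, s, l) x := by
  simp [mono]

/-- Stated for arbitrary `X` because it serves twice: for the negative part of the induced module,
and with `X = F` for the positive part modelled by the same operators. -/
theorem f_monomial_apply {X : Type*} [AddCommGroup X] [Module F X] (hq : q ^ d = 1) (hq0 : q ≠ 0)
    (hq1 : q ^ 2 - 1 ≠ 0) (w : ℕ) (s l : Fin 2) (x : X) :
    (indF₁ F d X ^ w) (((indF₂ q d X * indF₁ F d X - q • (indF₁ F d X * indF₂ q d X)) ^ (s : ℕ))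
      ((indF₂ q d X ^ (l : ℕ)) (mono F d 0 0 0 x))) = mono F d w s l x := by
  have h : (indF₂ q d X ^ (l : ℕ)) (mono F d 0 0 0 x) = mono F d 0 0 l x := by
    fin_cases l <;> simp [indF₂_mono hq, indF₂Fun]
  have h' (y : X) : ((indF₂ q d X * indF₁ F d X - q • (indF₁ F d X * indF₂ q d X)) ^ (s : ℕ))
      (mono F d 0 0 l y) = mono F d 0 s l y := by
    fin_cases s
    · simp
    · simpa using ind_f₃_mono_zero q hq hq0 hq1 l y
  rw [h, h', indF₁_pow_mono, zero_add]

/-- On the cyclic vector `v` the `e`s move only the innermost coordinate, then the `k`s the torus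
coordinate, then the `f`s the outer one, so the monomial can be read off from its value. -/
theorem linearIndependent_pbw [NeZero d] (hd : 1 < d) (hq : q ^ d = 1) (hq0 : q ≠ 0)
    (hq2 : IsPrimitiveRoot (q ^ 2) d) :
    LinearIndependent F fun p => proj F q d (pbw q d p) := by
  have hq1 : q ^ 2 - 1 ≠ 0 := sub_ne_zero.2 (hq2.ne_one hd)
  let ρ : BorelAction q d (ZMod d × ZMod d → Ind d F) := borelRegular hq hq0 hq1
  let R := ρ.ind hd hq hq0 hq2
  let v : Ind d (ZMod d × ZMod d → Ind d F) := mono F d 0 0 0 (Pi.single 0 (mono F d 0 0 0 1))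
  have he₁ (y : Ind d F) : ρ.e₁ (Pi.single 0 y) = Pi.single 0 (indF₁ F d F y) :=
    weighted_single_zero _ (by simp) _ _
  have he₂ (y : Ind d F) : ρ.e₂ (Pi.single 0 y) = Pi.single 0 (indF₂ q d F y) :=
    weighted_single_zero _ (by simp) _ _
  let c := indF₂ q d F * indF₁ F d F - q • (indF₁ F d F * indF₂ q d F)
  -- Since `e₃ = -q⁻¹ (e₂ e₁ - q e₁ e₂)`, it acts as `-q⁻¹` times the analogue of `f₃`.
  have he₃ (y : Ind d F) : R.liftU (e₃ F q) (mono F d 0 0 0 (Pi.single 0 y)) =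
      mono F d 0 0 0 (Pi.single 0 (((-q⁻¹) • c) y)) := by
    have hy : ((-q⁻¹) • c) y = indF₁ F d F (indF₂ q d F y) - q⁻¹ • indF₂ q d F (indF₁ F d F y) := by
      simp [c, smul_smul, hq0, sub_eq_add_neg, add_comm]
    rw [hy]
    simp only [e₃, map_sub, map_mul, map_smul, R.liftU_e₁, R.liftU_e₂, LinearMap.sub_apply,
      LinearMap.smul_apply, Module.End.mul_apply, Pi.single_sub, Pi.single_smul]
    simp only [R, BorelAction.ind, ρ.indE₁_mono_zero hq, ρ.indE₂_mono_zero, he₁, he₂]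
  have key (p) : R.lift (proj F q d (pbw q d p)) v = (-q⁻¹) ^ (p.2.2.2.2.2.2.1 : ℕ) •
      Pi.single (p.1, p.2.1, p.2.2.1) (Pi.single (((p.2.2.2.1 : ℕ) : ZMod d), ((p.2.2.2.2.1 : ℕ) : ZMod d))
        (Pi.single (p.2.2.2.2.2.1, p.2.2.2.2.2.2.1, p.2.2.2.2.2.2.2) 1)) := by
    obtain ⟨w, s, l, i, j, r, h, t⟩ := p
    have hE₁ (y : Ind d F) : R.e₁ (mono F d 0 0 0 (Pi.single 0 y)) =
        mono F d 0 0 0 (Pi.single 0 (indF₁ F d F y)) := by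
      rw [← he₁]; exact ρ.indE₁_mono_zero hq _
    have hE₂ (y : Ind d F) : R.e₂ (mono F d 0 0 0 (Pi.single 0 y)) =
        mono F d 0 0 0 (Pi.single 0 (indF₂ q d F y)) := by
      rw [← he₂]; exact ρ.indE₂_mono_zero _
    have hf₃ : R.liftU (f₃ F q) = indF₂ q d _ * indF₁ F d _ - q • (indF₁ F d _ * indF₂ q d _) := by
      simp [f₃, R, BorelAction.ind]
    have hk : (ρ.k₁ ^ (i : ℕ)) ((ρ.k₂ ^ (j : ℕ)) (Pi.single 0 (mono F d r h t 1))) =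
        Pi.single (((i : ℕ) : ZMod d), ((j : ℕ) : ZMod d)) (mono F d r h t 1) := by
      simp [ρ, borelRegular, translate_pow, translate_single]
    simp only [R.lift_proj, pbw, map_mul, map_pow, R.liftU_e₁, R.liftU_e₂, R.liftU_f₁, R.liftU_f₂,
      R.liftU_k₁, R.liftU_k₂, Module.End.mul_apply, v]
    rw [pow_apply_of_intertwines hE₂, pow_apply_of_intertwines he₃, pow_apply_of_intertwines hE₁,
      smul_pow, LinearMap.smul_apply, map_smul, f_monomial_apply hq hq0 hq1, Pi.single_smul,
      map_smul, map_smul, map_smul, map_smul, map_smul, map_smul,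
      show R.k₂ = ρ.indK₂ from rfl, show R.k₁ = ρ.indK₁ from rfl,
      pow_apply_of_intertwines ρ.indK₂_mono_zero, pow_apply_of_intertwines ρ.indK₁_mono_zero, hf₃,
      hk]
    exact congrArg _ ((f_monomial_apply hq hq0 hq1 _ _ _ _).trans
      (by rw [mono_fin, mono_fin]))
  have hcast (i j : Fin d) (hij : i ≠ j) : ((j : ℕ) : ZMod d) ≠ ((i : ℕ) : ZMod d) := fun h =>
    hij (Fin.ext (by
      have := congrArg ZMod.val h
      rwa [ZMod.val_natCast_of_lt j.2, ZMod.val_natCast_of_lt i.2, eq_comm] at this))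
  -- The dual family evaluates at `v`, takes the matching coordinate and divides by the factor
  -- `(-q⁻¹)ʰ` left by `e₃ʰ`.
  refine LinearIndependent.of_pairwise_dual_eq_zero_one _ (fun p =>
    ((-q⁻¹) ^ (p.2.2.2.2.2.2.1 : ℕ))⁻¹ •
      (LinearMap.proj (p.2.2.2.2.2.1, p.2.2.2.2.2.2.1, p.2.2.2.2.2.2.2) ∘ₗ
        LinearMap.proj (((p.2.2.2.1 : ℕ) : ZMod d), ((p.2.2.2.2.1 : ℕ) : ZMod d)) ∘ₗ
        LinearMap.proj (p.1, p.2.1, p.2.2.1) ∘ₗ LinearMap.applyₗ v ∘ₗ R.lift.toLinearMap))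
    ?_ ?_
  · intro p p' hp
    simp only [LinearMap.smul_apply, LinearMap.comp_apply, AlgHom.toLinearMap_apply,
      LinearMap.applyₗ_apply_apply, key, LinearMap.proj_apply, Pi.smul_apply]
    by_cases h₁ : (p.1, p.2.1, p.2.2.1) = (p'.1, p'.2.1, p'.2.2.1)
    · by_cases h₂ : (((p.2.2.2.1 : ℕ) : ZMod d), ((p.2.2.2.2.1 : ℕ) : ZMod d)) =
          (((p'.2.2.2.1 : ℕ) : ZMod d), ((p'.2.2.2.2.1 : ℕ) : ZMod d))
      · have h₃ : (p.2.2.2.2.2.1, p.2.2.2.2.2.2.1, p.2.2.2.2.2.2.2) ≠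
            (p'.2.2.2.2.2.1, p'.2.2.2.2.2.2.1, p'.2.2.2.2.2.2.2) := by
          intro h₃
          simp only [Prod.mk.injEq] at h₁ h₂ h₃
          have h₄ : p.2.2.2.1 = p'.2.2.2.1 := by
            by_contra hne; exact hcast _ _ hne h₂.1.symm
          have h₅ : p.2.2.2.2.1 = p'.2.2.2.2.1 := by
            by_contra hne; exact hcast _ _ hne h₂.2.symm
          exact hp (Prod.ext h₁.1 (Prod.ext h₁.2.1 (Prod.ext h₁.2.2 (Prod.ext h₄ (Prod.ext h₅
            (Prod.ext h₃.1 (Prod.ext h₃.2.1 h₃.2.2)))))))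
        rw [h₁, h₂, Pi.single_eq_same, Pi.single_eq_same, Pi.single_eq_of_ne h₃, smul_zero,
          smul_zero]
      · rw [h₁, Pi.single_eq_same, Pi.single_eq_of_ne h₂]
        simp
    · rw [Pi.single_eq_of_ne h₁]
      simp
  · intro p
    simp only [LinearMap.smul_apply, LinearMap.comp_apply, AlgHom.toLinearMap_apply,
      LinearMap.applyₗ_apply_apply, key, LinearMap.proj_apply, Pi.smul_apply, Pi.single_eq_same]
    rw [smul_smul, inv_mul_cancel₀ (pow_ne_zero _ (neg_ne_zero.2 (inv_ne_zero hq0))), one_smul]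

end Independence
-- Ordered monomials and the triangular decomposition
section Spanning

variable {F : Type*} [Field F] {q : F} {d : ℕ} {A : Type*} [Ring A] [Algebra F A]

/-- A submodule that contains `1` and is stable under left multiplication by `G` contains the
subalgebra generated by `G`. -/
theorem adjoin_le_of_mul_mem {G : Set A} {N : Submodule F A} (h1 : 1 ∈ N)
    (h : ∀ g ∈ G, ∀ x ∈ N, g * x ∈ N) : Subalgebra.toSubmodule (Algebra.adjoin F G) ≤ N := by
  have key : ∀ a ∈ Algebra.adjoin F G, ∀ x ∈ N, a * x ∈ N := by
    intro a ha
    induction ha using Algebra.adjoin_induction with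
    | mem g hg => exact h g hg
    | algebraMap c => intro x hx; rw [← Algebra.smul_def]; exact N.smul_mem c hx
    | add a b _ _ iha ihb => intro x hx; rw [add_mul]; exact N.add_mem (iha x hx) (ihb x hx)
    | mul a b _ _ iha ihb => intro x hx; rw [mul_assoc]; exact iha _ (ihb x hx)
  intro a ha
  simpa using key a ha 1 h1

/-- The span is stable under left multiplication by `a` and `b`. The parameter `μ` lets one
statement cover `c = f₃` (`μ = 1`) and `c = e₃` (`μ = -q`). -/
theorem adjoin_pair_le_span {a b c : A} {μ : F} (ha : a ^ d = 0) (hbb : b * b = 0)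
    (hba : b * a = q • (a * b) + μ • c) (hca : c * a = q⁻¹ • (a * c))
    (hbc : b * c = -(q • (c * b))) (hcc : c * c = 0) :
    Subalgebra.toSubmodule (Algebra.adjoin F {a, b}) ≤
      Submodule.span F (Set.range fun p : Fin d × Fin 2 × Fin 2 =>
        a ^ (p.1 : ℕ) * c ^ (p.2.1 : ℕ) * b ^ (p.2.2 : ℕ)) := by
  set N := Submodule.span F (Set.range fun p : Fin d × Fin 2 × Fin 2 =>
    a ^ (p.1 : ℕ) * c ^ (p.2.1 : ℕ) * b ^ (p.2.2 : ℕ)) with hN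
  have hmem (w : ℕ) (s l : Fin 2) : a ^ w * c ^ (s : ℕ) * b ^ (l : ℕ) ∈ N := by
    by_cases hw : w < d
    · exact Submodule.subset_span ⟨(⟨w, hw⟩, s, l), rfl⟩
    · rw [pow_eq_zero_of_le (not_lt.1 hw) ha, zero_mul, zero_mul]
      exact N.zero_mem
  have stable {g : A} (hg : ∀ (w : ℕ) (s l : Fin 2), g * (a ^ w * c ^ (s : ℕ) * b ^ (l : ℕ)) ∈ N) :
      ∀ x ∈ N, g * x ∈ N := by
    intro x hx
    induction hx using Submodule.span_induction with
    | mem x hx => obtain ⟨p, rfl⟩ := hx; exact hg _ _ _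
    | zero => rw [mul_zero]; exact N.zero_mem
    | add x y _ _ ihx ihy => rw [mul_add]; exact N.add_mem ihx ihy
    | smul r x _ ih => rw [mul_smul_comm]; exact N.smul_mem r ih
  have hA : ∀ x ∈ N, a * x ∈ N := stable fun w s l => by
    rw [← mul_assoc, ← mul_assoc, ← pow_succ']
    exact hmem _ _ _
  -- Stability under `c` is needed first, because moving `b` past `a` creates a `c`.
  have hC : ∀ x ∈ N, c * x ∈ N := stable fun w s l => by
    induction w with
    | zero =>
      fin_cases s
      · simpa using hmem 0 1 l
      · simp [← mul_assoc, hcc]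
    | succ w ih =>
      rw [pow_succ', mul_assoc a, mul_assoc a, ← mul_assoc c, hca, smul_mul_assoc, mul_assoc a c]
      exact N.smul_mem _ (hA _ ih)
  have hB : ∀ x ∈ N, b * x ∈ N := stable fun w s l => by
    induction w with
    | zero =>
      fin_cases s <;> fin_cases l
      · simpa using hmem 0 0 1
      · simp [hbb]
      · simpa [hbc] using N.smul_mem q (hmem 0 1 1)
      · simp [← mul_assoc, hbc, mul_assoc c b, hbb]
    | succ w ih =>
      rw [pow_succ', mul_assoc a, mul_assoc a, ← mul_assoc b, hba, add_mul, smul_mul_assoc,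
        mul_assoc a b, smul_mul_assoc]
      exact N.add_mem (N.smul_mem _ (hA _ ih)) (N.smul_mem _ (hC _ (hmem _ _ _)))
  refine adjoin_le_of_mul_mem (by simpa using hmem 0 0 0) ?_
  rintro g (rfl | rfl)
  exacts [hA, hB]

theorem adjoin_comm_pair_le_span [NeZero d] {a b : A} (ha : a ^ d = 1) (hb : b ^ d = 1)
    (hba : b * a = a * b) :
    Subalgebra.toSubmodule (Algebra.adjoin F {a, b}) ≤
      Submodule.span F (Set.range fun p : Fin d × Fin d => a ^ (p.1 : ℕ) * b ^ (p.2 : ℕ)) := by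
  set N := Submodule.span F (Set.range fun p : Fin d × Fin d =>
    a ^ (p.1 : ℕ) * b ^ (p.2 : ℕ)) with hN
  have hmem (i j : ℕ) : a ^ i * b ^ j ∈ N := by
    rw [pow_eq_pow_mod i ha, pow_eq_pow_mod j hb]
    exact Submodule.subset_span
      ⟨(⟨i % d, Nat.mod_lt _ (NeZero.pos d)⟩, ⟨j % d, Nat.mod_lt _ (NeZero.pos d)⟩), rfl⟩
  have stable {g : A} (hg : ∀ i j : ℕ, g * (a ^ i * b ^ j) ∈ N) : ∀ x ∈ N, g * x ∈ N := by
    intro x hx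
    induction hx using Submodule.span_induction with
    | mem x hx => obtain ⟨p, rfl⟩ := hx; exact hg _ _
    | zero => rw [mul_zero]; exact N.zero_mem
    | add x y _ _ ihx ihy => rw [mul_add]; exact N.add_mem ihx ihy
    | smul r x _ ih => rw [mul_smul_comm]; exact N.smul_mem r ih
  refine adjoin_le_of_mul_mem (by simpa using hmem 0 0) ?_
  rintro g (rfl | rfl)
  · exact stable fun i j => by rw [← mul_assoc, ← pow_succ']; exact hmem _ _
  · exact stable fun i j => by
      rw [← mul_assoc, (Commute.pow_right hba i : g * a ^ i = a ^ i * g), mul_assoc, ← pow_succ']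
      exact hmem _ _

/-! ### Relations for the root vector `b a - q a b` -/

section RootVector

variable {a b : A}

/-- The difference of the two sides is the Serre expression itself. -/
theorem rootVector_mul_left (hq0 : q ≠ 0)
    (hs : a ^ 2 * b - (q + q⁻¹) • (a * b * a) + b * a ^ 2 = 0) :
    (b * a - q • (a * b)) * a = q⁻¹ • (a * (b * a - q • (a * b))) := by
  rw [← sub_eq_zero, ← hs]
  simp only [sub_mul, mul_sub, smul_mul_assoc, mul_smul_comm, pow_two, mul_assoc]
  match_scalars <;> field_simp
  ring

theorem mul_rootVector (hb : b ^ 2 = 0) :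
    b * (b * a - q • (a * b)) = -(q • ((b * a - q • (a * b)) * b)) := by
  rw [pow_two] at hb
  simp [sub_mul, mul_sub, mul_assoc, ← mul_assoc b b, hb]

/-- Expanding the right factor of `c * c` and moving the left `c` through it gives `c² = -q⁻² c²`,
that is `(q² + 1) c² = 0`. -/
theorem rootVector_sq (hq0 : q ≠ 0) (hq : q ^ 2 + 1 ≠ 0)
    (hs : a ^ 2 * b - (q + q⁻¹) • (a * b * a) + b * a ^ 2 = 0) (hb : b ^ 2 = 0) :
    (b * a - q • (a * b)) * (b * a - q • (a * b)) = 0 := by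
  set c := b * a - q • (a * b) with hc
  have hca : c * a = q⁻¹ • (a * c) := rootVector_mul_left hq0 hs
  have hcb : c * b = -(q⁻¹ • (b * c)) := by
    rw [mul_rootVector hb, ← hc, smul_neg, smul_smul, inv_mul_cancel₀ hq0, one_smul, neg_neg]
  have h : c * c = -((q⁻¹ ^ 2) • (c * c)) := by
    conv_lhs => rw [hc, ← hc, mul_sub, ← mul_assoc, hcb, mul_smul_comm, ← mul_assoc, hca]
    simp only [neg_mul, smul_mul_assoc, mul_assoc, hca, hcb, mul_smul_comm, mul_neg]
    conv_rhs => rw [hc, ← hc, sub_mul, smul_mul_assoc]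
    simp only [mul_assoc]
    module
  have h' : (q ^ 2 + 1) • (c * c) = 0 := by
    rw [add_smul, one_smul]
    nth_rewrite 1 [h]
    rw [smul_neg, smul_smul, ← mul_pow, mul_inv_cancel₀ hq0, one_pow, one_smul, neg_add_cancel]
  exact (smul_eq_zero.1 h').resolve_left hq

end RootVector

/-! ### Triangular decomposition for any realization -/

namespace Realization

variable (R : Realization q d A)

/-- The subalgebra generated by `f₁, f₂`. -/
def negPart : Subalgebra F A := Algebra.adjoin F {R.f₁, R.f₂}

/-- The subalgebra generated by `k₁, k₂`. -/
def torus : Subalgebra F A := Algebra.adjoin F {R.k₁, R.k₂}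

/-- The subalgebra generated by `e₁, e₂`. -/
def posPart : Subalgebra F A := Algebra.adjoin F {R.e₁, R.e₂}

/-- The triangular product, as a submodule. -/
def triangular : Submodule F A :=
  Subalgebra.toSubmodule R.negPart * Subalgebra.toSubmodule R.torus *
    Subalgebra.toSubmodule R.posPart

theorem k₁_mem : R.k₁ ∈ R.torus := Algebra.subset_adjoin (by simp)
theorem k₂_mem : R.k₂ ∈ R.torus := Algebra.subset_adjoin (by simp)
theorem e₁_mem : R.e₁ ∈ R.posPart := Algebra.subset_adjoin (by simp)
theorem e₂_mem : R.e₂ ∈ R.posPart := Algebra.subset_adjoin (by simp)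
theorem f₁_mem : R.f₁ ∈ R.negPart := Algebra.subset_adjoin (by simp)
theorem f₂_mem : R.f₂ ∈ R.negPart := Algebra.subset_adjoin (by simp)

theorem k₁'_mem (hd : d ≠ 0) : R.k₁' ∈ R.torus := by
  obtain ⟨n, rfl⟩ := Nat.exists_eq_succ_of_ne_zero hd
  have : R.k₁' = R.k₁ ^ n := by
    rw [← mul_one R.k₁', ← R.k₁_pow, pow_succ', ← mul_assoc, R.k₁'_k₁, one_mul]
  rw [this]
  exact pow_mem R.k₁_mem n

theorem k₂'_mem (hd : d ≠ 0) : R.k₂' ∈ R.torus := by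
  obtain ⟨n, rfl⟩ := Nat.exists_eq_succ_of_ne_zero hd
  have : R.k₂' = R.k₂ ^ n := by
    rw [← mul_one R.k₂', ← R.k₂_pow, pow_succ', ← mul_assoc, R.k₂'_k₂, one_mul]
  rw [this]
  exact pow_mem R.k₂_mem n

theorem mul_mem_mul_left {S T : Submodule F A} {g : A} (h : ∀ x ∈ S, g * x ∈ S) :
    ∀ x ∈ S * T, g * x ∈ S * T := by
  have : S * T ≤ (S * T).comap (LinearMap.mulLeft F g) := Submodule.mul_le.2 fun m hm n hn => by
    rw [Submodule.mem_comap, LinearMap.mulLeft_apply, ← mul_assoc]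
    exact Submodule.mul_mem_mul (h m hm) hn
  exact this

theorem torus_mul_negPart :
    Subalgebra.toSubmodule R.torus * Subalgebra.toSubmodule R.negPart ≤
      Subalgebra.toSubmodule R.negPart * Subalgebra.toSubmodule R.torus := by
  set S := Subalgebra.toSubmodule R.negPart
  set T := Subalgebra.toSubmodule R.torus
  have hTT : T * T = T := (Subalgebra.isIdempotentElem_toSubmodule _).eq
  have hf₁ : ∀ x ∈ S * T, R.f₁ * x ∈ S * T := mul_mem_mul_left fun x hx => R.negPart.mul_mem R.f₁_mem hx
  have hf₂ : ∀ x ∈ S * T, R.f₂ * x ∈ S * T := mul_mem_mul_left fun x hx => R.negPart.mul_mem R.f₂_mem hx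
  have comm {k : A} {c₁ c₂ : F} (hk : k ∈ R.torus) (h₁ : k * R.f₁ = c₁ • (R.f₁ * k))
      (h₂ : k * R.f₂ = c₂ • (R.f₂ * k)) : ∀ x ∈ S * T, k * x ∈ S * T := by
    have hS : S ≤ (S * T).comap (LinearMap.mulLeft F k) := by
      refine adjoin_le_of_mul_mem ?_ ?_
      · simpa using Submodule.mul_mem_mul ((Subalgebra.mem_toSubmodule _).2 R.negPart.one_mem) ((Subalgebra.mem_toSubmodule _).2 hk)
      · rintro g (rfl | rfl) x hx <;>
          simp only [Submodule.mem_comap, LinearMap.mulLeft_apply] at hx ⊢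
        · rw [← mul_assoc, h₁, smul_mul_assoc, mul_assoc]
          exact Submodule.smul_mem _ _ (hf₁ _ hx)
        · rw [← mul_assoc, h₂, smul_mul_assoc, mul_assoc]
          exact Submodule.smul_mem _ _ (hf₂ _ hx)
    have : S * T ≤ (S * T).comap (LinearMap.mulLeft F k) := Submodule.mul_le.2 fun m hm n hn => by
      have := Submodule.mul_mem_mul (show k * m ∈ S * T from hS hm) hn
      rwa [mul_assoc S T T, hTT, mul_assoc] at this
    exact this
  refine Submodule.mul_le.2 fun t ht s hs => ?_
  have hT : T ≤ (S * T).comap (LinearMap.mulRight F s) := by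
    refine adjoin_le_of_mul_mem ?_ ?_
    · simpa using Submodule.mul_mem_mul hs ((Subalgebra.mem_toSubmodule _).2 R.torus.one_mem)
    · rintro g (rfl | rfl) x hx <;>
        simp only [Submodule.mem_comap, LinearMap.mulRight_apply, mul_assoc] at hx ⊢
      · exact comm R.k₁_mem R.k₁_f₁ R.k₁_f₂ _ hx
      · exact comm R.k₂_mem R.k₂_f₁ (by rw [R.k₂_f₂, one_smul]) _ hx
  exact hT ht

/-- Moving `e` past the negative part leaves `e` on the right plus torus terms; moving it past the
torus costs scalars; the positive part then absorbs it. The scalars `a₁`, `a₂` accommodate the sign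
in `e₂ f₂`. -/
theorem triangular_mul_mem {e : A} (he : e ∈ R.posPart) {c₁ c₂ a₁ a₂ : F} {h₁ h₂ : A}
    (hh₁ : h₁ ∈ R.torus) (hh₂ : h₂ ∈ R.torus) (ek₁ : e * R.k₁ = c₁ • (R.k₁ * e))
    (ek₂ : e * R.k₂ = c₂ • (R.k₂ * e)) (ef₁ : e * R.f₁ = a₁ • (R.f₁ * e) + h₁)
    (ef₂ : e * R.f₂ = a₂ • (R.f₂ * e) + h₂) : ∀ x ∈ R.triangular, e * x ∈ R.triangular := by
  set S := Subalgebra.toSubmodule R.negPart with hS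
  set T := Subalgebra.toSubmodule R.torus with hT
  set Q := Subalgebra.toSubmodule R.posPart with hQ
  set E := Submodule.span F {e}
  have hTT : T * T = T := (Subalgebra.isIdempotentElem_toSubmodule _).eq
  have hE : e ∈ E := Submodule.mem_span_singleton_self e
  have hEQ : E * Q ≤ Q := Submodule.mul_le.2 fun x hx y hy => by
    obtain ⟨r, rfl⟩ := Submodule.mem_span_singleton.1 hx
    exact R.posPart.mul_mem (R.posPart.smul_mem he r) hy
  have hET : T ≤ (T * E).comap (LinearMap.mulLeft F e) := by
    refine adjoin_le_of_mul_mem ?_ ?_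
    · simpa using Submodule.mul_mem_mul ((Subalgebra.mem_toSubmodule _).2 R.torus.one_mem) hE
    · rintro g (rfl | rfl) x hx <;>
        simp only [Submodule.mem_comap, LinearMap.mulLeft_apply] at hx ⊢
      · rw [← mul_assoc, ek₁, smul_mul_assoc, mul_assoc]
        exact Submodule.smul_mem _ _ (mul_mem_mul_left (fun x hx => R.torus.mul_mem R.k₁_mem hx) _ hx)
      · rw [← mul_assoc, ek₂, smul_mul_assoc, mul_assoc]
        exact Submodule.smul_mem _ _ (mul_mem_mul_left (fun x hx => R.torus.mul_mem R.k₂_mem hx) _ hx)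
  -- The intersection with `S` keeps `x` in the negative part, so that the extra term `h * x` can be
  -- reordered into `S * T`.
  have step {f h : A} {a : F} (hf : f ∈ R.negPart) (hh : h ∈ R.torus)
      (ef : e * f = a • (f * e) + h) :
      ∀ x ∈ S ⊓ (S * E ⊔ S * T).comap (LinearMap.mulLeft F e),
        f * x ∈ S ⊓ (S * E ⊔ S * T).comap (LinearMap.mulLeft F e) := by
    rintro x ⟨hxS, hx⟩
    refine ⟨R.negPart.mul_mem hf hxS, ?_⟩
    simp only [SetLike.mem_coe, Submodule.mem_comap, LinearMap.mulLeft_apply] at hx ⊢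
    rw [← mul_assoc, ef, add_mul, smul_mul_assoc, mul_assoc]
    refine add_mem (Submodule.smul_mem _ _ ?_) (Submodule.mem_sup_right
      (R.torus_mul_negPart (Submodule.mul_mem_mul ((Subalgebra.mem_toSubmodule _).2 hh) hxS)))
    rw [← Submodule.mul_sup] at hx ⊢
    exact mul_mem_mul_left (fun x hx => R.negPart.mul_mem hf hx) _ hx
  have hES : S ≤ S ⊓ (S * E ⊔ S * T).comap (LinearMap.mulLeft F e) := by
    refine adjoin_le_of_mul_mem ⟨R.negPart.one_mem, ?_⟩ ?_
    · simpa using Submodule.mem_sup_left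
        (Submodule.mul_mem_mul ((Subalgebra.mem_toSubmodule _).2 R.negPart.one_mem) hE)
    · rintro g (rfl | rfl)
      exacts [step R.f₁_mem hh₁ ef₁, step R.f₂_mem hh₂ ef₂]
  have h₁ : E * S ≤ S * E ⊔ S * T := Submodule.mul_le.2 fun x hx y hy => by
    obtain ⟨r, rfl⟩ := Submodule.mem_span_singleton.1 hx
    rw [smul_mul_assoc]
    exact Submodule.smul_mem _ _ (hES hy).2
  have h₂ : E * T ≤ T * E := Submodule.mul_le.2 fun x hx y hy => by
    obtain ⟨r, rfl⟩ := Submodule.mem_span_singleton.1 hx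
    rw [smul_mul_assoc]
    exact Submodule.smul_mem _ _ (hET hy)
  have h₃ : E * (S * T * Q) ≤ S * T * Q :=
    calc E * (S * T * Q) = E * S * (T * Q) := by simp only [mul_assoc]
      _ ≤ (S * E ⊔ S * T) * (T * Q) := mul_le_mul_left h₁ _
      _ = S * (E * T) * Q ⊔ S * (T * T) * Q := by simp only [Submodule.sup_mul, mul_assoc]
      _ ≤ S * (T * E) * Q ⊔ S * (T * T) * Q :=
        sup_le_sup_right (mul_le_mul_left (mul_le_mul_right h₂ _) _) _
      _ = S * T * (E * Q) ⊔ S * T * Q := by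
        rw [hTT]; simp only [mul_assoc]
      _ ≤ S * T * Q := sup_le (mul_le_mul_right hEQ _) le_rfl
  exact fun x hx => h₃ (Submodule.mul_mem_mul hE hx)

theorem adjoin_range_le_triangular (hd : d ≠ 0) :
    Subalgebra.toSubmodule (Algebra.adjoin F (Set.range R.onGen)) ≤ R.triangular := by
  have hk {k : A} (hk : k ∈ R.torus) : ∀ x ∈ R.triangular, k * x ∈ R.triangular :=
    mul_mem_mul_left fun x hx => by
      have := Submodule.mul_mem_mul ((Subalgebra.mem_toSubmodule _).2 hk) hx
      rw [← mul_assoc] at this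
      have := mul_le_mul_left R.torus_mul_negPart _ this
      rwa [mul_assoc, (Subalgebra.isIdempotentElem_toSubmodule R.torus).eq] at this
  have hf {f : A} (hf : f ∈ R.negPart) : ∀ x ∈ R.triangular, f * x ∈ R.triangular :=
    mul_mem_mul_left (mul_mem_mul_left fun x hx => R.negPart.mul_mem hf hx)
  refine adjoin_le_of_mul_mem ?_ ?_
  · simpa [triangular] using Submodule.mul_mem_mul (Submodule.mul_mem_mul ((Subalgebra.mem_toSubmodule _).2 R.negPart.one_mem)
      ((Subalgebra.mem_toSubmodule _).2 R.torus.one_mem)) ((Subalgebra.mem_toSubmodule _).2 R.posPart.one_mem)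
  · rintro g ⟨_ | _ | _ | _ | _ | _ | _ | _, rfl⟩
    · exact hk R.k₁_mem
    · exact hk (R.k₁'_mem hd)
    · exact hk R.k₂_mem
    · exact hk (R.k₂'_mem hd)
    · exact R.triangular_mul_mem R.e₁_mem
        (R.torus.smul_mem (sub_mem R.k₁_mem (R.k₁'_mem hd)) _) (zero_mem _) R.e₁_k₁ R.e₁_k₂
        (by rw [onGen, R.e₁_f₁, one_smul]) (by rw [onGen, R.e₁_f₂, one_smul, add_zero])
    · exact R.triangular_mul_mem R.e₂_mem (zero_mem _)
        (R.torus.smul_mem (sub_mem R.k₂_mem (R.k₂'_mem hd)) _) R.e₂_k₁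
        (by rw [onGen, R.e₂_k₂, one_smul]) (by rw [onGen, R.e₂_f₁, one_smul, add_zero])
        (by rw [onGen, R.e₂_f₂, neg_one_smul])
    · exact hf R.f₁_mem
    · exact hf R.f₂_mem

theorem negPart_le_span (hq0 : q ≠ 0) (hq : q ^ 2 + 1 ≠ 0) :
    Subalgebra.toSubmodule R.negPart ≤
      Submodule.span F (Set.range fun p : Fin d × Fin 2 × Fin 2 =>
        R.f₁ ^ (p.1 : ℕ) * (R.f₂ * R.f₁ - q • (R.f₁ * R.f₂)) ^ (p.2.1 : ℕ) * R.f₂ ^ (p.2.2 : ℕ)) :=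
  adjoin_pair_le_span (μ := 1) R.f₁_pow (by rw [← pow_two, R.f₂_sq])
    (by rw [one_smul, add_sub_cancel]) (rootVector_mul_left hq0 R.serre_f)
    (mul_rootVector R.f₂_sq) (rootVector_sq hq0 hq R.serre_f R.f₂_sq)

theorem posPart_le_span (hq0 : q ≠ 0) (hq : q ^ 2 + 1 ≠ 0) :
    Subalgebra.toSubmodule R.posPart ≤
      Submodule.span F (Set.range fun p : Fin d × Fin 2 × Fin 2 =>
        R.e₁ ^ (p.1 : ℕ) * (R.e₁ * R.e₂ - q⁻¹ • (R.e₂ * R.e₁)) ^ (p.2.1 : ℕ) *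
          R.e₂ ^ (p.2.2 : ℕ)) := by
  -- Rescaling by `-q⁻¹` turns `e₃` into the root vector of the pair `e₁, e₂`, so the same lemmas
  -- apply.
  have h : R.e₁ * R.e₂ - q⁻¹ • (R.e₂ * R.e₁) = -q⁻¹ • (R.e₂ * R.e₁ - q • (R.e₁ * R.e₂)) := by
    rw [smul_sub, smul_smul, neg_mul, inv_mul_cancel₀ hq0]
    module
  refine adjoin_pair_le_span (q := q) (μ := -q) R.e₁_pow (by rw [← pow_two, R.e₂_sq]) ?_ ?_ ?_ ?_
  · rw [h, smul_smul, neg_mul_neg, mul_inv_cancel₀ hq0, one_smul, add_sub_cancel]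
  · rw [h, smul_mul_assoc, rootVector_mul_left hq0 R.serre_e, mul_smul_comm, smul_comm]
  · rw [h, smul_mul_assoc, mul_smul_comm, mul_rootVector R.e₂_sq, smul_neg, smul_comm]
  · rw [h, smul_mul_smul_comm, rootVector_sq hq0 hq R.serre_e R.e₂_sq, smul_zero]

theorem adjoin_range_le_span [NeZero d] (hq0 : q ≠ 0) (hq : q ^ 2 + 1 ≠ 0) :
    Subalgebra.toSubmodule (Algebra.adjoin F (Set.range R.onGen)) ≤
      Submodule.span F (Set.range fun p : (Fin d × Fin 2 × Fin 2) × (Fin d × Fin d) ×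
          (Fin d × Fin 2 × Fin 2) =>
        (R.f₁ ^ (p.1.1 : ℕ) * (R.f₂ * R.f₁ - q • (R.f₁ * R.f₂)) ^ (p.1.2.1 : ℕ) *
          R.f₂ ^ (p.1.2.2 : ℕ)) * (R.k₁ ^ (p.2.1.1 : ℕ) * R.k₂ ^ (p.2.1.2 : ℕ)) *
        (R.e₁ ^ (p.2.2.1 : ℕ) * (R.e₁ * R.e₂ - q⁻¹ • (R.e₂ * R.e₁)) ^ (p.2.2.2.1 : ℕ) *
          R.e₂ ^ (p.2.2.2.2 : ℕ))) := by
  refine (R.adjoin_range_le_triangular (NeZero.ne d)).trans ?_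
  refine (mul_le_mul' (mul_le_mul' (R.negPart_le_span hq0 hq)
    (adjoin_comm_pair_le_span R.k₁_pow R.k₂_pow R.k₂_k₁)) (R.posPart_le_span hq0 hq)).trans ?_
  rw [Submodule.span_mul_span, Submodule.span_mul_span]
  refine Submodule.span_mono ?_
  rintro _ ⟨_, ⟨_, ⟨p, rfl⟩, _, ⟨p', rfl⟩, rfl⟩, _, ⟨p'', rfl⟩, rfl⟩
  exact ⟨(p, p', p''), rfl⟩

end Realization
end Spanning
-- Spanning in `Ū_q` through its tautological realization
section Basis

variable {F : Type*} [Field F] {q : F} {d : ℕ}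

variable (q d) in
/-- The class of a generator in `Ū_q`. -/
def uBarGen (g : Gen) : UBar F q d := proj F q d (uGen F q g)

/-- The generators of `Ū_q` satisfy the defining relations. -/
theorem rel_proj {x y : FreeAlgebra F Gen} (h : Rel F q x y) :
    proj F q d (RingQuot.mkAlgHom F (Rel F q) x) = proj F q d (RingQuot.mkAlgHom F (Rel F q) y) :=
  congrArg _ (RingQuot.mkAlgHom_rel F h)

theorem proj_eq_zero {x : U F q}
    (h : x ∈ ({f₁ F q ^ d, k₁ F q ^ d - 1, k₂ F q ^ d - 1, e₁ F q ^ d} : Set (U F q))) :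
    proj F q d x = 0 := by
  have : x ∈ I F q d := TwoSidedIdeal.subset_span h
  exact ((I F q d).ringCon.eq).2 this

variable (F q d) in
/-- The tautological realization in `Ū_q`. -/
def tautological : Realization q d (UBar F q d) where
  k₁ := uBarGen q d .k1
  k₁' := uBarGen q d .k1inv
  k₂ := uBarGen q d .k2
  k₂' := uBarGen q d .k2inv
  e₁ := uBarGen q d .e1
  e₂ := uBarGen q d .e2
  f₁ := uBarGen q d .f1
  f₂ := uBarGen q d .f2
  k₁_k₁' := by simpa [uBarGen, uGen] using rel_proj (F := F) (q := q) (d := d) .k1_k1inv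
  k₁'_k₁ := by simpa [uBarGen, uGen] using rel_proj (F := F) (q := q) (d := d) .k1inv_k1
  k₂_k₂' := by simpa [uBarGen, uGen] using rel_proj (F := F) (q := q) (d := d) .k2_k2inv
  k₂'_k₂ := by simpa [uBarGen, uGen] using rel_proj (F := F) (q := q) (d := d) .k2inv_k2
  k₂_k₁ := by simpa [uBarGen, uGen] using rel_proj (F := F) (q := q) (d := d) .k2_k1
  e₁_k₁ := by simpa [uBarGen, uGen] using rel_proj (F := F) (q := q) (d := d) .e1_k1
  e₂_k₁ := by simpa [uBarGen, uGen] using rel_proj (F := F) (q := q) (d := d) .e2_k1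
  e₁_k₂ := by simpa [uBarGen, uGen] using rel_proj (F := F) (q := q) (d := d) .e1_k2
  e₂_k₂ := by simpa [uBarGen, uGen] using rel_proj (F := F) (q := q) (d := d) .e2_k2
  k₁_f₁ := by simpa [uBarGen, uGen] using rel_proj (F := F) (q := q) (d := d) .k1_f1
  k₁_f₂ := by simpa [uBarGen, uGen] using rel_proj (F := F) (q := q) (d := d) .k1_f2
  k₂_f₁ := by simpa [uBarGen, uGen] using rel_proj (F := F) (q := q) (d := d) .k2_f1
  k₂_f₂ := by simpa [uBarGen, uGen] using rel_proj (F := F) (q := q) (d := d) .k2_f2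
  e₁_f₁ := by simpa [uBarGen, uGen] using rel_proj (F := F) (q := q) (d := d) .e1_f1
  e₂_f₂ := by simpa [uBarGen, uGen] using rel_proj (F := F) (q := q) (d := d) .e2_f2
  e₁_f₂ := by simpa [uBarGen, uGen] using rel_proj (F := F) (q := q) (d := d) .e1_f2
  e₂_f₁ := by simpa [uBarGen, uGen] using rel_proj (F := F) (q := q) (d := d) .e2_f1
  e₂_sq := by simpa [uBarGen, uGen] using rel_proj (F := F) (q := q) (d := d) .e2_sq
  f₂_sq := by simpa [uBarGen, uGen] using rel_proj (F := F) (q := q) (d := d) .f2_sq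
  serre_e := by simpa [uBarGen, uGen] using rel_proj (F := F) (q := q) (d := d) .serre_e
  serre_f := by simpa [uBarGen, uGen] using rel_proj (F := F) (q := q) (d := d) .serre_f
  f₁_pow := by
    simpa [uBarGen, f₁] using proj_eq_zero (F := F) (q := q) (d := d) (x := f₁ F q ^ d) (by simp)
  k₁_pow := by
    simpa [uBarGen, k₁, sub_eq_zero] using
      proj_eq_zero (F := F) (q := q) (d := d) (x := k₁ F q ^ d - 1) (by simp)
  k₂_pow := by
    simpa [uBarGen, k₂, sub_eq_zero] using
      proj_eq_zero (F := F) (q := q) (d := d) (x := k₂ F q ^ d - 1) (by simp)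
  e₁_pow := by
    simpa [uBarGen, e₁] using proj_eq_zero (F := F) (q := q) (d := d) (x := e₁ F q ^ d) (by simp)

theorem adjoin_range_tautological :
    Algebra.adjoin F (Set.range (tautological F q d).onGen) = ⊤ := by
  let π : FreeAlgebra F Gen →ₐ[F] UBar F q d := (proj F q d).comp (RingQuot.mkAlgHom F (Rel F q))
  have hπ : Function.Surjective π :=
    (RingCon.mk'_surjective _).comp (RingQuot.mkAlgHom_surjective F (Rel F q))
  have hgen : (tautological F q d).onGen = π ∘ FreeAlgebra.ι F := by
    funext g
    cases g <;> rfl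
  rw [hgen, Set.range_comp, ← AlgHom.map_adjoin, FreeAlgebra.adjoin_range_ι, Algebra.map_top,
    (AlgHom.range_eq_top _).2 hπ]

theorem span_pbw [NeZero d] (hq0 : q ≠ 0) (hq : q ^ 2 + 1 ≠ 0) :
    ⊤ ≤ Submodule.span F (Set.range fun p => proj F q d (pbw q d p)) := by
  have h := (tautological F q d).adjoin_range_le_span hq0 hq
  rw [adjoin_range_tautological, Algebra.top_toSubmodule] at h
  refine h.trans (Submodule.span_mono ?_)
  rintro _ ⟨⟨⟨w, s, l⟩, ⟨i, j⟩, r, h, t⟩, rfl⟩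
  refine ⟨(w, s, l, i, j, r, h, t), ?_⟩
  simp only [pbw, e₃, f₃, map_mul, map_pow, map_sub, map_smul, mul_assoc]
  rfl

end Basis
end QuantumSl21

/-! ### The basis and the dimension -/

open QuantumSl21 in
theorem mainTheorem6 (F : Type*) [Field F] [CharZero F] (d : ℕ) (hd_odd : Odd d) (hd : 3 ≤ d)
    (q : F) (hq : IsPrimitiveRoot q d) :
    (∃ b : Module.Basis
        (Fin d × Fin 2 × Fin 2 × Fin d × Fin d × Fin d × Fin 2 × Fin 2) F (UBar F q d),
      ∀ (w : Fin d) (s l : Fin 2) (i j r : Fin d) (h t : Fin 2),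
        b (w, s, l, i, j, r, h, t) =
          proj F q d
            (f₁ F q ^ (w : ℕ) * f₃ F q ^ (s : ℕ) * f₂ F q ^ (l : ℕ) *
              k₁ F q ^ (i : ℕ) * k₂ F q ^ (j : ℕ) *
              e₁ F q ^ (r : ℕ) * e₃ F q ^ (h : ℕ) * e₂ F q ^ (t : ℕ))) ∧
      Module.Finite F (UBar F q d) ∧
      Module.finrank F (UBar F q d) = 16 * d ^ 4 := by
  have : NeZero d := ⟨by omega⟩
  have hq0 : q ≠ 0 := hq.ne_zero (by omega)
  have hq2 : IsPrimitiveRoot (q ^ 2) d := hq.pow_of_coprime 2 (Nat.coprime_two_left.2 hd_odd)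
  -- If `q² = -1` then `(q²)² = 1`, which would force the order `d ≥ 3` of `q²` to divide `2`.
  have hq4 : q ^ 2 + 1 ≠ 0 := fun h => by
    have h1 : (q ^ 2) ^ 2 = 1 := by linear_combination (q ^ 2 - 1) * h
    have := Nat.le_of_dvd two_pos (hq2.dvd_of_pow_eq_one 2 h1)
    omega
  let b := Module.Basis.mk (linearIndependent_pbw (by omega) hq.pow_eq_one hq0 hq2)
    (span_pbw (F := F) (d := d) hq0 hq4)
  refine ⟨⟨b, fun w s l i j r h t => ?_⟩, Module.Finite.of_basis b, ?_⟩
  · simp only [b, Module.Basis.mk_apply, pbw]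
  · rw [Module.finrank_eq_card_basis b]
    simp only [Fintype.card_prod, Fintype.card_fin]
    ring
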